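/- Below, a binary CSS code of length $N$ is given by two commuting sets of stabilizer generators, $X(g)$ for $g$ in a first list of vectors of $GF(2)^N$ and $Z(h)$ for $h$ in a second list, where $X(u)|a\rangle=|a+u\rangle$ and $Z(v)|a\rangle=(-1)^{v\cdot a}|a\rangle$ on $\mathbb C^{2^N}$. It is an $[[N,k,d_Z/d_X]]$ code if the common fixed space of the generators has dimension $2^k$, and $d_Z$ (resp. $d_X$) is the least weight of a $Z(v)$ (resp. $X(u)$) that commutes with all generators but is not in the stabilizer group. The syndrome has one bit per generator, which tells whether the error anticommutes with it. A decoder maps the syndrome to a correction $X(u')Z(v')$; the error $X(u)Z(v)$ is corrected if applying the correction restores every code state up to a global phase. Decoders are bit-level programs (for each code its own): in each time step every processor applies one Boolean operation to two bits of a common memory (which initially holds the syndrome) and stores the result in a new cell; the sequential case is that of one processor. There are lengths $N_0<N_1<\dots$, with $N_0\ge 2$, constants $\delta,C>0$, and, for every $N$ in this sequence, a binary CSS code $\mathscr Q$ with at most $N$ generators and parameters $$[[N,\ k\ge \delta N/\log N,\ d_Z\ge \delta N/\log N\,/\,d_X\ge \delta\log N]],$$ which has - a sequential decoder that runs in at most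 $CN$ time steps, and - a parallel decoder that runs in at most $C\log N$ time steps on at most $CN$ processors, each of which has the following two properties. 1. It corrects every $Z$-error of weight at most $\delta N/\log N$ (an almost linear number of $Z$-errors). 2. It corrects a linear number of random $X$-errors with high probability: if every qubit independently suffers an $X$-error with probability $p$ (so that $pN$ errors are expected), then for all constants $c>0$ and $0\le p<1/4^{c+1}$ the probability $\mathcal P$ that the $X$-error is not corrected, alone or together with some $Z$-error of weight at most $\delta N/\log N$, satisfies $N^{c}\,\mathcal P\to 0$ as $N\to\infty$ along the sequence. -/

import Mathlib

open Filter Topology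
open scoped Matrix

/-- A vector of `N` bits, i.e. an element of `GF(2)^N`. -/
abbrev Bits (N : ℕ) : Type := Fin N → ZMod 2

/-- The state space `ℂ^(2^N)` of `N` qubits: a vector is given by its amplitudes in the
computational basis `|a⟩`, `a ∈ GF(2)^N`. -/
abbrev QState (N : ℕ) : Type := Bits N → ℂ

/-- The operator `X(u)`, defined by `X(u)|a⟩ = |a + u⟩`. -/
def pauliX {N : ℕ} (u : Bits N) : QState N →ₗ[ℂ] QState N where
  toFun ψ := fun a => ψ (a - u)
  map_add' _ _ := rfl
  map_smul' _ _ := rfl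

/-- The operator `Z(v)`, defined by `Z(v)|a⟩ = (-1)^(v·a)|a⟩`. -/
def pauliZ {N : ℕ} (v : Bits N) : QState N →ₗ[ℂ] QState N where
  toFun ψ := fun a => (-1 : ℂ) ^ (v ⬝ᵥ a).val * ψ a
  map_add' ψ φ := by
    funext a
    exact mul_add _ _ _
  map_smul' z ψ := by
    funext a
    exact mul_left_comm _ _ _

/-- A binary CSS stabilizer code of length `N`, given by its stabilizer generators:
`X(g)` for the rows `g` of `xStab` and `Z(h)` for the rows `h` of `zStab`.
The generators commute; they are not required to be independent. -/
structure CSSCode (N : ℕ) where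
  /-- number of generators of type `X` -/
  rX : ℕ
  /-- number of generators of type `Z` -/
  rZ : ℕ
  xStab : Matrix (Fin rX) (Fin N) (ZMod 2)
  zStab : Matrix (Fin rZ) (Fin N) (ZMod 2)
  comm : xStab * zStabᵀ = 0

namespace CSSCode

variable {N : ℕ}

/-- The quantum code itself: the states that are fixed by every stabilizer generator. -/
def codeSpace (Q : CSSCode N) : Submodule ℂ (QState N) where
  carrier := {ψ | (∀ i, pauliX (Q.xStab i) ψ = ψ) ∧ (∀ j, pauliZ (Q.zStab j) ψ = ψ)}
  add_mem' := by
    intro a b ha hb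
    exact ⟨fun i => by rw [map_add, ha.1 i, hb.1 i], fun j => by rw [map_add, ha.2 j, hb.2 j]⟩
  zero_mem' := ⟨fun i => map_zero _, fun j => map_zero _⟩
  smul_mem' := by
    intro c a ha
    exact ⟨fun i => by rw [map_smul, ha.1 i], fun j => by rw [map_smul, ha.2 j]⟩

/-- The `Z`-distance: the least weight of a `Z(v)` that commutes with all generators
but is not in the stabilizer group. -/
noncomputable def distZ (Q : CSSCode N) : ℕ :=
  sInf {w | ∃ v : Bits N, Q.xStab *ᵥ v = 0 ∧
    v ∉ Submodule.span (ZMod 2) (Set.range Q.zStab) ∧ hammingNorm v = w}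

/-- The `X`-distance: the least weight of an `X(u)` that commutes with all generators
but is not in the stabilizer group. -/
noncomputable def distX (Q : CSSCode N) : ℕ :=
  sInf {w | ∃ u : Bits N, Q.zStab *ᵥ u = 0 ∧
    u ∉ Submodule.span (ZMod 2) (Set.range Q.xStab) ∧ hammingNorm u = w}

/-- A syndrome: one bit for every stabilizer generator. -/
abbrev Syndrome (Q : CSSCode N) : Type := Fin Q.rX ⊕ Fin Q.rZ → ZMod 2

/-- The syndrome of the error `X(u)Z(v)`: the bit of a generator is `1` if and only if the error
anticommutes with it. -/
def syndrome (Q : CSSCode N) (u v : Bits N) : Q.Syndrome :=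
  Sum.elim (Q.xStab *ᵥ v) (Q.zStab *ᵥ u)

/-- The decoder `D` maps a syndrome to a correction `X(u')Z(v')` (the bits `Sum.inl j` of its output
form `u'`, the bits `Sum.inr j` form `v'`). It corrects the error `X(u)Z(v)` if applying
the correction belonging to the syndrome of the error restores every code state,
up to a global phase. -/
def Corrects (Q : CSSCode N) (D : Q.Syndrome → (Fin N ⊕ Fin N → ZMod 2)) (u v : Bits N) : Prop :=
  ∃ ζ : ℂ, ‖ζ‖ = 1 ∧ ∀ ψ ∈ Q.codeSpace,
    pauliX (fun j => D (Q.syndrome u v) (Sum.inl j))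
      (pauliZ (fun j => D (Q.syndrome u v) (Sum.inr j)) (pauliX u (pauliZ v ψ))) = ζ • ψ

end CSSCode

/-- The probability that the random vector `u ∈ GF(2)^N`, whose coordinates are independent and
equal to `1` with probability `p`, lies in `S`. -/
noncomputable def bernoulliProb {N : ℕ} (p : ℝ) (S : Set (Bits N)) : ℝ :=
  ∑ u : Bits N, S.indicator (fun u => p ^ hammingNorm u * (1 - p) ^ (N - hammingNorm u)) u

/-- A bit-level program for `P` processors with a common memory that runs for `T` time steps, with
input bits indexed by `ι` and output bits indexed by `κ`. In time step `t` each processor `q` reads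
two memory cells, `src₁ t q` and `src₂ t q`, applies one Boolean operation to the two bits, and
writes the resulting bit to the memory cell `(t, q)`. The cells `Sum.inl i` hold the input. With
`P = 1` this is a sequential (straight-line) program with running time `T`. -/
structure BitProgram (ι κ : Type) (P T : ℕ) where
  op : Fin T → Fin P → ZMod 2 → ZMod 2 → ZMod 2
  src₁ : Fin T → Fin P → ι ⊕ (Fin T × Fin P)
  src₂ : Fin T → Fin P → ι ⊕ (Fin T × Fin P)
  out : κ → ι ⊕ (Fin T × Fin P)

namespace BitProgram

variable {ι κ : Type} {P T : ℕ}

/-- The content of the memory after `t` time steps on input `x`. Unwritten cells contain `0`. -/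
def mem (A : BitProgram ι κ P T) (x : ι → ZMod 2) : ℕ → ι ⊕ (Fin T × Fin P) → ZMod 2
  | 0 => Sum.elim x (fun _ => 0)
  | t + 1 => Sum.elim x (fun c =>
      if c.1.val = t then
        A.op c.1 c.2 (A.mem x t (A.src₁ c.1 c.2)) (A.mem x t (A.src₂ c.1 c.2))
      else A.mem x t (Sum.inr c))

/-- The output of the program: the designated cells after all `T` time steps. -/
def eval (A : BitProgram ι κ P T) (x : ι → ZMod 2) : κ → ZMod 2 :=
  fun k => A.mem x T (A.out k)

end BitProgram

/-- A decoder for a CSS code that runs on `P` processors in `T` time steps. -/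
abbrev Decoder {N : ℕ} (Q : CSSCode N) (P T : ℕ) : Type :=
  BitProgram (Fin Q.rX ⊕ Fin Q.rZ) (Fin N ⊕ Fin N) P T

/-- The error correction capability of the decoders `D i` of the codes `Q i` of length `N i`:
every `Z`-error of weight at most `δ N / log N` is corrected and, if every qubit independently
suffers an `X`-error with probability `p < 1 / 4 ^ (c + 1)`, then, except with probability
`o(N ^ (-c))`, the `X`-error is corrected together with any such `Z`-error. -/
def CorrectsErrors (N : ℕ → ℕ) (Q : ∀ i, CSSCode (N i))
    (D : ∀ i, (Q i).Syndrome → (Fin (N i) ⊕ Fin (N i) → ZMod 2)) (δ : ℝ) : Prop :=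
  (∀ i, ∀ v : Bits (N i), (hammingNorm v : ℝ) ≤ δ * N i / Real.log (N i) →
    (Q i).Corrects (D i) 0 v) ∧
  (∀ c : ℝ, 0 < c → ∀ p : ℝ, 0 ≤ p → p < 1 / 4 ^ (c + 1) →
    Tendsto (fun i => (N i : ℝ) ^ c * bernoulliProb p {u : Bits (N i) |
        ∃ v : Bits (N i), (hammingNorm v : ℝ) ≤ δ * N i / Real.log (N i) ∧
          ¬ (Q i).Corrects (D i) u v})
      atTop (𝓝 0))

/-! The codes are concatenated. The outer code is a classical expander code of length `4 * M` with
`2 * M` checks, used against `Z`-errors; each of its bits is replaced by a block of `q + 1` qubits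
carrying a repetition code, used against `X`-errors. The `Z`-generators compare bits inside a block,
and the `X`-generators are the outer checks repeated on whole blocks. There are `4 * M * q + 2 * M`
generators, so at least `2 * M` logical qubits remain.

A `Z`-error matters only through its block parities: a vector with zero parities is a product of
`Z`-generators (`mem_span_zStab_of_blockParity`). Parities do not increase weight, so the outer
decoder needs to handle only as many errors as there are faulty qubits. It is parallel bit flipping:
on a graph with nearly full expansion each round at least halves the error
(`two_mul_hammingNorm_add_flips_le`), so logarithmically many rounds of bounded time suffice.
Counting gives such a graph (`exists_expander`), and splitting its checks bounds the degrees.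

An `X`-error is removed by a majority vote in every block, computed by adders in time linear in the
block length. Decoding fails only if at least half of some block is wrong
(`bernoulliProb_blocks_le`).

With `M = 2 ^ 2 ^ i` and blocks of length `256 * 2 ^ i`, the block length and the number of rounds
are both of order `log N`, and `N / log N` is of order `M`. One processor per block then gives time
`O(log N)`; the total work is `O(N)`, so simulating the processors one after another gives the
sequential decoder. -/

namespace BitProgram

/-! ### Composition, parallel execution and sequential simulation of programs -/

variable {ι κ μ : Type} {P T : ℕ}

theorem mem_inl (A : BitProgram ι κ P T) (x : ι → ZMod 2) (t : ℕ) (i : ι) :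
    A.mem x t (Sum.inl i) = x i := by
  cases t <;> rfl

theorem mem_succ_inr (A : BitProgram ι κ P T) (x : ι → ZMod 2) (t : ℕ) (c : Fin T × Fin P) :
    A.mem x (t + 1) (Sum.inr c) = if c.1.val = t then
        A.op c.1 c.2 (A.mem x t (A.src₁ c.1 c.2)) (A.mem x t (A.src₂ c.1 c.2))
      else A.mem x t (Sum.inr c) := rfl

theorem mem_of_le (A : BitProgram ι κ P T) (x : ι → ZMod 2) (t : ℕ) (c : Fin T × Fin P)
    (h : t ≤ c.1.val) : A.mem x t (Sum.inr c) = 0 := by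
  induction t with
  | zero => rfl
  | succ t ih => rw [mem_succ_inr, if_neg (by omega), ih (by omega)]

theorem mem_of_lt (A : BitProgram ι κ P T) (x : ι → ZMod 2) (t : ℕ) (c : Fin T × Fin P)
    (h : c.1.val < t) : A.mem x t (Sum.inr c) = A.mem x (c.1.val + 1) (Sum.inr c) := by
  induction t with
  | zero => omega
  | succ t ih =>
    rcases Nat.lt_succ_iff_lt_or_eq.1 h with h | h
    · rw [mem_succ_inr, if_neg (by omega), ih h]
    · rw [h]

theorem mem_add (A : BitProgram ι κ P T) (x : ι → ZMod 2) (t : ℕ) (z : ι ⊕ (Fin T × Fin P)) :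
    A.mem x (T + t) z = A.mem x T z := by
  rcases z with i | c
  · rw [mem_inl, mem_inl]
  · rw [mem_of_lt _ _ _ _ (by omega), mem_of_lt _ _ T _ (by omega)]

/-- The cells of the first of two consecutively executed programs. -/
def fstCell {T₁ : ℕ} (T₂ : ℕ) : ι ⊕ (Fin T₁ × Fin P) → ι ⊕ (Fin (T₁ + T₂) × Fin P) :=
  Sum.map id (Prod.map (Fin.castAdd T₂) id)

/-- The cells of the second of two consecutively executed programs. -/
def sndCell {T₁ T₂ : ℕ} (A : BitProgram ι κ P T₁) :
    κ ⊕ (Fin T₂ × Fin P) → ι ⊕ (Fin (T₁ + T₂) × Fin P) :=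
  Sum.elim (fun k => fstCell T₂ (A.out k)) (fun c => Sum.inr (Prod.map (Fin.natAdd T₁) id c))

/-- Run `A`, then run `B` on the output of `A`. -/
def comp {T₁ T₂ : ℕ} (B : BitProgram κ μ P T₂) (A : BitProgram ι κ P T₁) :
    BitProgram ι μ P (T₁ + T₂) where
  op := Fin.addCases A.op B.op
  src₁ := Fin.addCases (fun t q => fstCell T₂ (A.src₁ t q)) (fun t q => sndCell A (B.src₁ t q))
  src₂ := Fin.addCases (fun t q => fstCell T₂ (A.src₂ t q)) (fun t q => sndCell A (B.src₂ t q))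
  out := fun k => sndCell A (B.out k)

theorem comp_mem_fst {T₁ T₂ : ℕ} (B : BitProgram κ μ P T₂) (A : BitProgram ι κ P T₁)
    (x : ι → ZMod 2) (t : ℕ) (z : ι ⊕ (Fin T₁ × Fin P)) :
    (B.comp A).mem x t (fstCell T₂ z) = A.mem x t z := by
  induction t generalizing z with
  | zero => rcases z with i | c <;> rfl
  | succ t ih =>
    rcases z with i | c
    · rfl
    · have h : (fstCell T₂ (Sum.inr c) : ι ⊕ (Fin (T₁ + T₂) × Fin P)) =
        Sum.inr (Fin.castAdd T₂ c.1, c.2) := rfl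
      have ih' := ih (Sum.inr c)
      rw [h] at ih'
      rw [h, mem_succ_inr, mem_succ_inr, ih']
      simp [comp, ← ih]

/-- After time `T₁` the cells of `A` are frozen, so its output cells serve as constant input cells
of `B`; the cells of `B` are still blank at that moment. -/
theorem comp_mem_snd {T₁ T₂ : ℕ} (B : BitProgram κ μ P T₂) (A : BitProgram ι κ P T₁)
    (x : ι → ZMod 2) (t : ℕ) (z : κ ⊕ (Fin T₂ × Fin P)) :
    (B.comp A).mem x (T₁ + t) (sndCell A z) = B.mem (A.eval x) t z := by
  induction t generalizing z with
  | zero =>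
    rcases z with i | c
    · exact comp_mem_fst B A x T₁ (A.out i)
    · exact mem_of_le _ _ _ _ (by simp)
  | succ t ih =>
    rcases z with i | c
    · rw [mem_inl]
      show (B.comp A).mem x (T₁ + (t + 1)) (fstCell T₂ (A.out i)) = _
      rw [comp_mem_fst, mem_add]
      rfl
    · have h : (sndCell A (Sum.inr c) : ι ⊕ (Fin (T₁ + T₂) × Fin P)) =
        Sum.inr (Fin.natAdd T₁ c.1, c.2) := rfl
      have ih' := ih (Sum.inr c)
      rw [h] at ih'
      rw [h, ← add_assoc, mem_succ_inr, mem_succ_inr, ih']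
      simp [comp, ← ih]

theorem comp_eval {T₁ T₂ : ℕ} (B : BitProgram κ μ P T₂) (A : BitProgram ι κ P T₁)
    (x : ι → ZMod 2) : (B.comp A).eval x = B.eval (A.eval x) := by
  funext k
  exact comp_mem_snd B A x T₂ (B.out k)

/-- The cells of processor `q` among `P` parallel ones. -/
def procCell (q : Fin P) : ι ⊕ (Fin T × Fin 1) → ι ⊕ (Fin T × Fin P) :=
  Sum.map id (fun c => (c.1, q))

/-- Each processor runs its own program. -/
def pi {κ : Fin P → Type} (A : ∀ q, BitProgram ι (κ q) 1 T) :
    BitProgram ι (Σ q, κ q) P T where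
  op t q := (A q).op t 0
  src₁ t q := procCell q ((A q).src₁ t 0)
  src₂ t q := procCell q ((A q).src₂ t 0)
  out k := procCell k.1 ((A k.1).out k.2)

theorem pi_mem {κ : Fin P → Type} (A : ∀ q, BitProgram ι (κ q) 1 T) (x : ι → ZMod 2) (t : ℕ)
    (q : Fin P) (z : ι ⊕ (Fin T × Fin 1)) :
    (pi A).mem x t (procCell q z) = (A q).mem x t z := by
  induction t generalizing z with
  | zero => rcases z with i | c <;> rfl
  | succ t ih =>
    rcases z with i | ⟨c, j⟩
    · rfl
    · obtain rfl : j = 0 := Subsingleton.elim _ _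
      have h : (procCell q (Sum.inr (c, 0)) : ι ⊕ (Fin T × Fin P)) = Sum.inr (c, q) := rfl
      have ih' := ih (Sum.inr (c, 0))
      rw [h] at ih'
      rw [h, mem_succ_inr, mem_succ_inr, ih']
      simp [pi, ← ih]

open Classical in
/-- The cell of the sequential program that plays the role of a source of the step `c`.
A cell that is not yet written at that time is replaced by the current one. -/
noncomputable def seqCell (c : Fin T × Fin P) :
    ι ⊕ (Fin T × Fin P) → ι ⊕ (Fin (T * P) × Fin 1) :=
  Sum.map id (fun c' => if c'.1 < c.1 then (finProdFinEquiv c', 0) else (finProdFinEquiv c, 0))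

/-- The sequential simulation of a parallel program. -/
noncomputable def sequential (A : BitProgram ι κ P T) : BitProgram ι κ 1 (T * P) where
  op s _ := A.op (finProdFinEquiv.symm s).1 (finProdFinEquiv.symm s).2
  src₁ s _ := seqCell (finProdFinEquiv.symm s)
    (A.src₁ (finProdFinEquiv.symm s).1 (finProdFinEquiv.symm s).2)
  src₂ s _ := seqCell (finProdFinEquiv.symm s)
    (A.src₂ (finProdFinEquiv.symm s).1 (finProdFinEquiv.symm s).2)
  out k := Sum.map id (fun c => (finProdFinEquiv c, 0)) (A.out k)

/-- The cells are filled in lexicographic order, so everything from earlier parallel steps is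
available. A cell of the same parallel step reads as `0` in the parallel run but may already be
filled in the sequential one; redirecting the read to the current cell, which is still blank,
supplies this `0`. -/
theorem sequential_mem (A : BitProgram ι κ P T) (x : ι → ZMod 2) (s : ℕ) (c : Fin T × Fin P) :
    A.sequential.mem x s (Sum.inr (finProdFinEquiv c, 0)) =
      if (finProdFinEquiv c).val < s then A.mem x T (Sum.inr c) else 0 := by
  induction s generalizing c with
  | zero => rfl
  | succ s ih =>
    have key : ∀ z : ι ⊕ (Fin T × Fin P), (finProdFinEquiv c).val = s →
        A.sequential.mem x s (seqCell c z) = A.mem x c.1.val z := by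
      intro z hc
      rcases z with i | c'
      · exact (mem_inl _ _ _ _).trans (mem_inl _ _ _ _).symm
      · by_cases h : c'.1 < c.1
        · have e : (seqCell c (Sum.inr c') : ι ⊕ (Fin (T * P) × Fin 1)) =
            Sum.inr (finProdFinEquiv c', 0) := by simp [seqCell, h]
          have h' : c'.1.val < c.1.val := h
          have : (finProdFinEquiv c').val < s := by
            rw [← hc]
            simp only [finProdFinEquiv_apply_val]
            have := c'.2.isLt
            nlinarith
          rw [e, ih, if_pos this, mem_of_lt _ _ _ _ c'.1.isLt, ← mem_of_lt _ _ _ _ h']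
        · have e : (seqCell c (Sum.inr c') : ι ⊕ (Fin (T * P) × Fin 1)) =
            Sum.inr (finProdFinEquiv c, 0) := by simp [seqCell, h]
          have h' : c.1.val ≤ c'.1.val := not_lt.1 h
          rw [e, ih, if_neg (by omega), mem_of_le _ _ _ _ h']
    rw [mem_succ_inr]
    by_cases hc : (finProdFinEquiv c).val = s
    · have h2 := mem_succ_inr A x c.1.val c
      rw [if_pos rfl] at h2
      rw [if_pos hc, if_pos (by omega), mem_of_lt _ _ _ _ c.1.isLt, h2,
        ← key _ hc, ← key _ hc]
      simp only [sequential, Equiv.symm_apply_apply]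
    · rw [if_neg hc, ih]
      simp only [Nat.lt_succ_iff_lt_or_eq, hc, or_false]

theorem sequential_eval (A : BitProgram ι κ P T) (x : ι → ZMod 2) :
    A.sequential.eval x = A.eval x := by
  funext k
  show A.sequential.mem x (T * P) (Sum.map id _ (A.out k)) = A.mem x T (A.out k)
  rcases A.out k with i | c
  · exact (mem_inl _ _ _ _).trans (mem_inl _ _ _ _).symm
  · exact (sequential_mem A x _ c).trans (if_pos (Fin.isLt _))

end BitProgram

/-! ### Calculus of computable maps -/

/-- The map `g` is computed by some program for `P` processors in `T` time steps. -/
def Computes {ι κ : Type} (P T : ℕ) (g : (ι → ZMod 2) → κ → ZMod 2) : Prop :=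
  ∃ A : BitProgram ι κ P T, ∀ x, A.eval x = g x

namespace Computes

variable {ι κ μ : Type} {P T T₁ T₂ : ℕ}

theorem congr {g g' : (ι → ZMod 2) → κ → ZMod 2} (h : Computes P T g) (e : ∀ x k, g x k = g' x k) :
    Computes P T g' := by
  have : g = g' := by funext x k; exact e x k
  exact this ▸ h

theorem proj (P T : ℕ) (φ : κ → ι) : Computes P T (fun x k => x (φ k)) :=
  ⟨⟨fun _ _ _ _ => 0, fun t q => Sum.inr (t, q), fun t q => Sum.inr (t, q),
    fun k => Sum.inl (φ k)⟩, fun _ => funext fun _ => BitProgram.mem_inl _ _ _ _⟩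

theorem comp {g : (ι → ZMod 2) → κ → ZMod 2} {h : (κ → ZMod 2) → μ → ZMod 2}
    (hh : Computes P T₂ h) (hg : Computes P T₁ g) : Computes P (T₁ + T₂) (fun x => h (g x)) := by
  obtain ⟨A, hA⟩ := hg
  obtain ⟨B, hB⟩ := hh
  exact ⟨B.comp A, fun x => by rw [BitProgram.comp_eval, hA, hB]⟩

theorem mono {g : (ι → ZMod 2) → κ → ZMod 2} (hg : Computes P T₁ g) (h : T₁ ≤ T₂) :
    Computes P T₂ g := by
  obtain ⟨d, rfl⟩ := Nat.exists_eq_add_of_le h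
  exact (proj P d id).comp hg

theorem postproj {g : (ι → ZMod 2) → κ → ZMod 2} (hg : Computes P T g) (φ : μ → κ) :
    Computes P T (fun x k => g x (φ k)) :=
  (proj P 0 φ).comp hg

theorem preproj {g : (ι → ZMod 2) → κ → ZMod 2} (hg : Computes P T g) (φ : ι → μ) :
    Computes P T (fun x => g (fun i => x (φ i))) :=
  (hg.comp (proj P 0 φ)).mono (by omega)

/-- A program may also output its input. -/
theorem keep {g : (ι → ZMod 2) → κ → ZMod 2} (hg : Computes P T g) :
    Computes P T (fun x => Sum.elim x (g x)) := by
  obtain ⟨A, hA⟩ := hg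
  refine ⟨⟨A.op, A.src₁, A.src₂, Sum.elim Sum.inl A.out⟩, fun x => ?_⟩
  have hm : ∀ t z, BitProgram.mem
      (⟨A.op, A.src₁, A.src₂, Sum.elim Sum.inl A.out⟩ : BitProgram ι (ι ⊕ κ) P T) x t z =
      A.mem x t z := by
    intro t
    induction t with
    | zero => intro z; rfl
    | succ t ih =>
      intro z
      rcases z with i | c
      · rfl
      · rw [BitProgram.mem_succ_inr, BitProgram.mem_succ_inr, ih, ih, ih]
  funext k
  rcases k with i | k
  · exact BitProgram.mem_inl _ _ _ _
  · exact (hm T _).trans (congrFun (hA x) k)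

theorem pair {g : (ι → ZMod 2) → κ → ZMod 2} {h : (ι → ZMod 2) → μ → ZMod 2}
    (hg : Computes P T₁ g) (hh : Computes P T₂ h) :
    Computes P (T₁ + T₂) (fun x => Sum.elim (g x) (h x)) := by
  refine (((hh.preproj (Sum.inl : ι → ι ⊕ κ)).keep.comp hg.keep).postproj
    (Sum.elim (fun k => Sum.inl (Sum.inr k)) Sum.inr : κ ⊕ μ → (ι ⊕ κ) ⊕ μ)).congr ?_
  rintro x (k | k) <;> rfl

theorem sequential {g : (ι → ZMod 2) → κ → ZMod 2} (hg : Computes P T g) :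
    Computes 1 (T * P) g := by
  obtain ⟨A, hA⟩ := hg
  exact ⟨A.sequential, fun x => by rw [BitProgram.sequential_eval, hA]⟩

theorem pi {κ : Fin P → Type} {g : ∀ q, (ι → ZMod 2) → κ q → ZMod 2}
    (hg : ∀ q, Computes 1 T (g q)) : Computes P T (fun x (k : Σ q, κ q) => g k.1 x k.2) := by
  choose A hA using hg
  refine ⟨BitProgram.pi A, fun x => funext fun k => ?_⟩
  show _ = g k.1 x k.2
  rw [← hA]
  exact BitProgram.pi_mem A x T k.1 _

/-- Each processor computes a single bit. -/
theorem pi_unit {g : Fin P → (ι → ZMod 2) → ZMod 2}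
    (hg : ∀ q, Computes 1 T (fun x (_ : Unit) => g q x)) :
    Computes P T (fun x q => g q x) :=
  (pi hg).postproj (fun q => ⟨q, ()⟩)

theorem gate [NeZero P] (op : ZMod 2 → ZMod 2 → ZMod 2) (a b : ι) :
    Computes P 1 (fun x (_ : Unit) => op (x a) (x b)) := by
  refine ⟨⟨fun _ _ => op, fun _ _ => Sum.inl a, fun _ _ => Sum.inl b, fun _ => Sum.inr (0, 0)⟩,
    fun x => ?_⟩
  funext k
  simp [BitProgram.eval, BitProgram.mem]

theorem const [NeZero P] (b : ZMod 2) : Computes P 1 (fun (_ : ι → ZMod 2) (_ : κ) => b) := by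
  refine ⟨⟨fun _ _ _ _ => b, fun _ _ => Sum.inr (0, 0), fun _ _ => Sum.inr (0, 0),
    fun _ => Sum.inr (0, 0)⟩, fun x => ?_⟩
  funext k
  simp [BitProgram.eval, BitProgram.mem]

theorem mux : Computes 1 3 (fun (x : Fin 3 → ZMod 2) (_ : Unit) =>
    if x 0 = 0 then x 1 else x 2) := by
  have h1 := (gate (P := 1) (· + ·) (1 : Fin 3) 2).keep
  have h2 := (gate (P := 1) (· * ·) (Sum.inl 0 : Fin 3 ⊕ Unit) (Sum.inr ())).keep
  have h3 := gate (P := 1) (· + ·) (Sum.inl (Sum.inl 1) : (Fin 3 ⊕ Unit) ⊕ Unit) (Sum.inr ())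
  refine (h3.comp (h2.comp h1)).congr ?_
  intro x _
  have key : ∀ a b c : ZMod 2, b + a * (b + c) = if a = 0 then b else c := by decide
  exact key _ _ _

open Classical in
/-- A Boolean function of boundedly many bits is computed in bounded time. -/
theorem of_dependsOn (D : Finset ι) (F : (ι → ZMod 2) → ZMod 2)
    (hF : ∀ x y, (∀ i ∈ D, x i = y i) → F x = F y) :
    Computes 1 (4 ^ (D.card + 1)) (fun x (_ : Unit) => F x) := by
  induction D using Finset.induction_on generalizing F with
  | empty =>
    exact ((const (F 0)).congr fun x _ => hF _ _ (by simp)).mono (by simp)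
  | insert a D ha ih =>
    have hd : ∀ b : ZMod 2, Computes 1 (4 ^ (D.card + 1))
        (fun x (_ : Unit) => F (Function.update x a b)) := by
      intro b
      refine ih (fun x => F (Function.update x a b)) fun x y h => hF _ _ fun i hi => ?_
      by_cases hia : i = a
      · subst hia; simp
      · simp only [Function.update_of_ne hia]
        exact h i ((Finset.mem_insert.1 hi).resolve_left hia)
    -- Shannon expansion: both restrictions of `F` are computed, and the bit `a` selects between
    -- them. The cost at most doubles plus `3`, which the base `4` absorbs.
    have h := mux.comp (((proj 1 0 (fun _ : Unit => a)).pair ((hd 0).pair (hd 1))).postproj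
      ![Sum.inl (), Sum.inr (Sum.inl ()), Sum.inr (Sum.inr ())])
    refine (h.congr (g' := fun x _ => F x) fun x _ => ?_).mono ?_
    · have h2 : ∀ b : ZMod 2, b ≠ 0 → b = 1 := by decide
      by_cases hx : x a = 0
      · simp only [Matrix.cons_val_zero, Sum.elim_inl, hx, if_true]
        simp [← hx]
      · have hx1 := h2 _ hx
        simp only [Matrix.cons_val_zero, Sum.elim_inl, hx, if_false]
        simp [← hx1]
    · rw [Finset.card_insert_of_notMem ha, pow_succ 4 (D.card + 1)]
      have : 4 ^ 1 ≤ 4 ^ (D.card + 1) := Nat.pow_le_pow_right (by norm_num) (by omega)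
      omega

end Computes

/-! ### Majority by adders and decoding of the repetition code -/

/-- One pass of full adders over `2 q + 1` bits: the last sum bit (index `0`) and the `q` carries. -/
theorem Computes.exists_carries (q : ℕ) :
    ∃ g : (Fin (2 * q + 1) → ZMod 2) → Fin (q + 1) → ZMod 2,
      Computes 1 (512 * q) g ∧
      ∀ x, ∑ i, (x i).val = 2 * ∑ i : Fin q, (g x i.succ).val + (g x 0).val := by
  induction q with
  | zero => exact ⟨fun x => x, (Computes.proj 1 0 id).mono (by omega), fun x => by simp⟩
  | succ q ih =>
    obtain ⟨g, hg, hgx⟩ := ih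
    let S : (Fin (q + 1) ⊕ Fin (2 * q + 1 + 1 + 1) → ZMod 2) → ZMod 2 :=
      fun z => z (Sum.inl 0) + z (Sum.inr 0) + z (Sum.inr 1)
    let C : (Fin (q + 1) ⊕ Fin (2 * q + 1 + 1 + 1) → ZMod 2) → ZMod 2 :=
      fun z => z (Sum.inl 0) * z (Sum.inr 0) + z (Sum.inl 0) * z (Sum.inr 1) +
        z (Sum.inr 0) * z (Sum.inr 1)
    classical
    have hcard : ({Sum.inl 0, Sum.inr 0, Sum.inr 1} :
        Finset (Fin (q + 1) ⊕ Fin (2 * q + 1 + 1 + 1))).card ≤ 3 := Finset.card_le_three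
    have hpow : 4 ^ (({Sum.inl 0, Sum.inr 0, Sum.inr 1} :
        Finset (Fin (q + 1) ⊕ Fin (2 * q + 1 + 1 + 1))).card + 1) ≤ 256 :=
      (Nat.pow_le_pow_right (by norm_num) (Nat.succ_le_succ hcard)).trans (by norm_num)
    have hS : Computes 1 256 (fun z (_ : Unit) => S z) :=
      (of_dependsOn _ S fun x y h => by
        simp only [S]
        rw [h (Sum.inl 0) (by simp), h (Sum.inr 0) (by simp), h (Sum.inr 1) (by simp)]).mono hpow
    have hC : Computes 1 256 (fun z (_ : Unit) => C z) :=
      (of_dependsOn _ C fun x y h => by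
        simp only [C]
        rw [h (Sum.inl 0) (by simp), h (Sum.inr 0) (by simp), h (Sum.inr 1) (by simp)]).mono hpow
    have h1 : Computes 1 (512 * q) (fun (x : Fin (2 * q + 1 + 1 + 1) → ZMod 2) =>
        Sum.elim (g fun i => x i.succ.succ) x) :=
      ((hg.preproj (fun i : Fin (2 * q + 1) => i.succ.succ)).keep).postproj
        (Sum.elim Sum.inr Sum.inl)
        |>.congr (by rintro x (k | k) <;> rfl)
    have h2 := ((hS.pair hC).keep.comp h1).postproj
      (Fin.cons (Sum.inr (Sum.inl ())) (Fin.cons (Sum.inr (Sum.inr ()))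
        (fun i : Fin q => Sum.inl (Sum.inl i.succ))) : Fin (q + 1 + 1) → _)
    refine ⟨_, h2.mono (by omega), fun x => ?_⟩
    show ∑ i : Fin (2 * q + 1 + 1 + 1), _ = _
    rw [Fin.sum_univ_succ, Fin.sum_univ_succ, Fin.sum_univ_succ (n := q)]
    have h3 := hgx (fun i => x i.succ.succ)
    simp only [Fin.cons_succ, Fin.cons_zero, Sum.elim_inr, Sum.elim_inl, S, C] at h3 ⊢
    rw [h3]
    -- The full adder identity: the sum bit of the previous pass and two new bits give one carry and
    -- one new sum bit.
    have key : ∀ a b c : ZMod 2, a.val + b.val + c.val =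
      2 * (c * a + c * b + a * b).val + (c + a + b).val := by decide
    have := key (x 0) (x 1) (g (fun i => x i.succ.succ) 0)
    simp only [Fin.succ_zero_eq_one] at *
    omega

/-- The majority of `2 ^ (r + 1) - 1` bits is computed in linear time. -/
theorem Computes.exists_majority (r : ℕ) :
    ∃ g : (Fin (2 ^ (r + 1) - 1) → ZMod 2) → ZMod 2,
      Computes 1 (512 * (2 ^ (r + 1) - 1)) (fun x (_ : Unit) => g x) ∧
      ∀ x, g x = 1 ↔ 2 ^ (r + 1) - 1 < 2 * ∑ i, (x i).val := by
  induction r with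
  | zero =>
    refine ⟨fun x => x (0 : Fin 1), (proj 1 0 (fun _ => (0 : Fin 1))).mono (by omega),
      fun x => ?_⟩
    have key : ∀ a : ZMod 2, a = 1 ↔ 1 < 2 * a.val := by decide
    have h := key (x (0 : Fin 1))
    show x (0 : Fin 1) = 1 ↔ 1 < 2 * ∑ i : Fin 1, (x i).val
    simpa using h
  | succ r ih =>
    obtain ⟨a, ha⟩ : ∃ a, a = 2 ^ (r + 1) - 1 := ⟨_, rfl⟩
    have hp : 2 ^ (r + 1) = 2 * 2 ^ r := by ring
    have hpos : 0 < 2 ^ r := by positivity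
    have h2 : 2 ^ (r + 1 + 1) - 1 = 2 * a + 1 := by rw [pow_succ]; omega
    rw [h2]
    rw [← ha] at ih
    obtain ⟨g, hg, hgx⟩ := ih
    obtain ⟨f, hf, hfx⟩ := exists_carries a
    -- The majority of `2 * a + 1` bits is that of the `a` carries. The discarded sum bit cannot
    -- matter: it could only decide whether twice the carry count is at least `a` or more than `a`,
    -- and `a` is odd. The number of bits halves, so the times form a geometric series.
    refine ⟨fun x => g (fun i => f x i.succ),
      ((hg.preproj Fin.succ).comp hf).mono (by omega), fun x => ?_⟩
    rw [hgx, hfx]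
    have := ZMod.val_lt (f x 0)
    omega

/-- Decoding the repetition code of length `2 ^ (r + 1)` in linear time, from the syndrome that
compares every other bit with the bit `0`. -/
theorem Computes.exists_repetition_decoder (r : ℕ) :
    ∃ g : (Fin (2 ^ (r + 1) - 1) → ZMod 2) → Fin (2 ^ (r + 1) - 1 + 1) → ZMod 2,
      Computes 1 (1024 * 2 ^ (r + 1)) g ∧
      ∀ u : Fin (2 ^ (r + 1) - 1 + 1) → ZMod 2, 2 * hammingNorm u < 2 ^ (r + 1) →
        g (fun i => u 0 + u i.succ) = u := by
  have hmaj := exists_majority r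
  have hpos : 0 < 2 ^ r := by positivity
  have hp : 2 ^ (r + 1) = 2 * 2 ^ r := by ring
  obtain ⟨a, ha⟩ : ∃ a, a = 2 ^ (r + 1) - 1 := ⟨_, rfl⟩
  rw [← ha] at hmaj ⊢
  obtain ⟨g, hg, hgx⟩ := hmaj
  have hsum : Computes 1 (1 * a) (fun (z : Fin a ⊕ Unit → ZMod 2) (i : Fin a) =>
      z (Sum.inl i) + z (Sum.inr ())) :=
    (pi_unit fun i => gate (· + ·) (Sum.inl i : Fin a ⊕ Unit) (Sum.inr ())).sequential
  have h := (hsum.keep.comp hg.keep).postproj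
    (Fin.cons (Sum.inl (Sum.inr ())) (fun i => Sum.inr i) : Fin (a + 1) → _)
  refine ⟨_, h.mono (by omega), fun u hu => ?_⟩
  have h2 : ∀ b : ZMod 2, b ≠ 0 → b = 1 := by decide
  have hn : hammingNorm u = ∑ i, (u i).val := by
    rw [hammingNorm, Finset.card_filter]
    refine Finset.sum_congr rfl fun i _ => ?_
    have : ∀ b : ZMod 2, (if b ≠ 0 then 1 else 0) = b.val := by decide
    exact this _
  rw [hn, Fin.sum_univ_succ] at hu
  -- If fewer than half of the bits are wrong, most of the others are `0`, so most differences from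
  -- bit `0` are equal to bit `0` itself.
  have hg0 : g (fun i => u 0 + u i.succ) = u 0 := by
    have hm := hgx (fun i => u 0 + u i.succ)
    by_cases h0 : u 0 = 0
    · rw [h0] at hm hu ⊢
      simp only [zero_add] at hm ⊢
      simp only [ZMod.val_zero] at hu
      by_contra hne
      have := hm.1 (h2 _ hne)
      omega
    · have h1 := h2 _ h0
      rw [h1] at hm hu ⊢
      rw [hm]
      have hc : ∀ b : ZMod 2, (1 + b).val + b.val = 1 := by decide
      have : ∑ i : Fin a, ((1 + u i.succ).val + (u i.succ).val) = a := by
        simp only [hc]; simp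
      rw [Finset.sum_add_distrib] at this
      have h1v : (1 : ZMod 2).val = 1 := rfl
      rw [h1v] at hu
      omega
  funext j
  refine Fin.cases ?_ (fun i => ?_) j
  · simpa using hg0
  · simp only [Fin.cons_succ, Sum.elim_inr, Sum.elim_inl, hg0]
    have : ∀ b c : ZMod 2, b + c + b = c := by decide
    exact this _ _

/-! ### Existence of bounded-degree expanders -/

/-- A crude Stirling bound: `s ^ s / s!` is one term of the exponential series at `s`, and `e < 3`.
-/
theorem pow_self_le_three_pow_mul_factorial (s : ℕ) : (s : ℝ) ^ s ≤ 3 ^ s * s.factorial := by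
  have h1 := Real.pow_div_factorial_le_exp (s : ℝ) (by positivity) s
  have h2 : Real.exp (s : ℝ) ≤ 3 ^ s := by
    rw [← mul_one (s : ℝ), Real.exp_nat_mul]
    exact pow_le_pow_left₀ (by positivity) (by linarith [Real.exp_one_lt_d9]) _
  rw [div_le_iff₀ (by positivity)] at h1
  exact h1.trans (by gcongr)

theorem choose_mul_pow_self_le (n s : ℕ) : (n.choose s : ℝ) * (s : ℝ) ^ s ≤ 3 ^ s * (n : ℝ) ^ s := by
  have h1 : (n.choose s : ℝ) * s.factorial ≤ (n : ℝ) ^ s := by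
    have := Nat.choose_le_pow_div (α := ℝ) s n
    rwa [le_div_iff₀ (by positivity)] at this
  calc (n.choose s : ℝ) * (s : ℝ) ^ s ≤ n.choose s * (3 ^ s * s.factorial) := by
        gcongr; exact pow_self_le_three_pow_mul_factorial s
    _ = 3 ^ s * (n.choose s * s.factorial) := by ring
    _ ≤ _ := by gcongr

/-- In probabilistic terms, a random map sends `S` into `T` with probability `(|T| / M) ^ |S|`; the
union bound below is carried out with these counts. -/
theorem card_functions_into (M : ℕ) {E : Type*} [Fintype E] [DecidableEq E] (S : Finset E)
    (T : Finset (Fin M)) :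
    ((Finset.univ.filter fun f : E → Fin M => ∀ e ∈ S, f e ∈ T).card : ℕ) =
      T.card ^ S.card * M ^ (Fintype.card E - S.card) := by
  have : (Finset.univ.filter fun f : E → Fin M => ∀ e ∈ S, f e ∈ T) =
      Fintype.piFinset (fun e => if e ∈ S then T else Finset.univ) := by
    ext f
    simp only [Finset.mem_filter, Finset.mem_univ, true_and, Fintype.mem_piFinset]
    refine forall_congr' fun e => ?_
    by_cases h : e ∈ S <;> simp [h]
  rw [this, Fintype.card_piFinset]
  have h2 : ∀ e, (if e ∈ S then T else Finset.univ).card = if e ∈ S then T.card else M := by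
    intro e; split_ifs <;> simp
  simp only [h2]
  rw [Finset.prod_ite]
  simp only [Finset.prod_const]
  congr 2
  · congr 1; ext; simp
  · rw [← Finset.card_univ, ← Finset.card_sdiff_of_subset (Finset.subset_univ _)]
    congr 1; ext; simp

/-- The term of the union bound that belongs to the sets of size `s`. -/
theorem union_bound_term (M s : ℕ) (hs : 0 < s) (hM : 3 ^ 30 * 43200 * s ≤ M) :
    ((4 * M).choose s : ℝ) * (M.choose (30 * s)) *
      ((30 * s : ℕ) ^ (32 * s) * (M : ℝ) ^ (128 * M - 32 * s)) ≤
      (1 / 4) ^ s * (M : ℝ) ^ (128 * M) := by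
  have hM0 : 0 < M := by
    refine lt_of_lt_of_le ?_ hM
    positivity
  have hsM : 32 * s ≤ 128 * M := by
    have : s ≤ 3 ^ 30 * 43200 * s := Nat.le_mul_of_pos_left _ (by norm_num)
    omega
  have h1 := choose_mul_pow_self_le (4 * M) s
  have h2 := choose_mul_pow_self_le M (30 * s)
  have hMr : (3 ^ 30 * 43200 * s : ℝ) ≤ M := by exact_mod_cast hM
  have hsp : (0 : ℝ) < s := by exact_mod_cast hs
  have hMp : (0 : ℝ) < M := by exact_mod_cast hM0
  have key : ((4 * M).choose s : ℝ) * (M.choose (30 * s)) * ((30 * s : ℕ) : ℝ) ^ (32 * s) ≤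
      (1 / 4) ^ s * (M : ℝ) ^ (32 * s) := by
    -- The factors `(30 * s) ^ (30 * s)` and `s ^ s` cancel the denominators of the two binomial
    -- bounds. What is left, `(900 * s) ^ s`, competes with a spare `M ^ s`. Hence the constant:
    -- `43200 = 3 * 4 * 900 * 4`, with the last `4` producing the decay `(1 / 4) ^ s`.
    have e1 : ((30 * s : ℕ) : ℝ) ^ (32 * s) =
        ((30 * s : ℕ) : ℝ) ^ (30 * s) * ((s : ℝ) ^ s * (900 * s) ^ s) := by
      rw [show 32 * s = 30 * s + (s + s) by ring, pow_add, pow_add, ← mul_pow, ← mul_pow]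
      push_cast
      congr 2
      ring
    calc _ = (M.choose (30 * s) * ((30 * s : ℕ) : ℝ) ^ (30 * s)) *
          ((4 * M).choose s * (s : ℝ) ^ s) * (900 * s) ^ s := by rw [e1]; ring
      _ ≤ (3 ^ (30 * s) * (M : ℝ) ^ (30 * s)) * (3 ^ s * ((4 * M : ℕ) : ℝ) ^ s) *
          (900 * s) ^ s := by gcongr
      _ = (M : ℝ) ^ (30 * s) * (M : ℝ) ^ s * ((1 / 4) * (3 ^ 30 * 43200 * s)) ^ s := by
          rw [pow_mul]
          push_cast
          rw [mul_pow 4 (M : ℝ)]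
          rw [show ((1 : ℝ) / 4 * (3 ^ 30 * 43200 * s)) = 3 ^ 30 * 3 * 4 * (900 * s) by ring,
            mul_pow, mul_pow, mul_pow]
          generalize (3 : ℝ) ^ 30 = w
          ring
      _ ≤ (M : ℝ) ^ (30 * s) * (M : ℝ) ^ s * ((1 / 4) * M) ^ s := by gcongr
      _ = _ := by
          rw [mul_pow, show 32 * s = 30 * s + s + s by ring, pow_add, pow_add]; ring
  calc _ = (((4 * M).choose s : ℝ) * (M.choose (30 * s)) * ((30 * s : ℕ) : ℝ) ^ (32 * s)) *
        (M : ℝ) ^ (128 * M - 32 * s) := by ring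
    _ ≤ ((1 / 4) ^ s * (M : ℝ) ^ (32 * s)) * (M : ℝ) ^ (128 * M - 32 * s) := by gcongr
    _ = _ := by rw [mul_assoc, ← pow_add, Nat.add_sub_cancel' hsM]

/-- Random bipartite graphs are good expanders. The `32` edges at a left vertex `v` are `(v, i)`. -/
theorem exists_expander (M : ℕ) (hM : 0 < M) : ∃ f : Fin (4 * M) × Fin 32 → Fin M,
    ∀ S : Finset (Fin (4 * M)), 3 ^ 30 * 43200 * S.card ≤ M →
      30 * S.card ≤ ((S ×ˢ Finset.univ).image f).card := by
  classical
  by_contra! hbad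
  let R := (Finset.range (M + 1)).filter fun s => 0 < s ∧ 3 ^ 30 * 43200 * s ≤ M
  let B : Finset (Fin (4 * M)) → Finset (Fin M) → Finset (Fin (4 * M) × Fin 32 → Fin M) :=
    fun S T => Finset.univ.filter fun f => ∀ e ∈ S ×ˢ Finset.univ, f e ∈ T
  have hcover : (Finset.univ : Finset (Fin (4 * M) × Fin 32 → Fin M)) ⊆
      R.biUnion fun s => (Finset.powersetCard s Finset.univ).biUnion fun S =>
        (Finset.powersetCard (30 * s) Finset.univ).biUnion fun T => B S T := by
    intro f _
    obtain ⟨S, hS, hf⟩ := hbad f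
    have hSpos : 0 < S.card := by
      by_contra h0
      have : S.card = 0 := by omega
      omega
    have hSM : 30 * S.card ≤ M := by
      have : 30 * S.card ≤ 3 ^ 30 * 43200 * S.card := Nat.mul_le_mul_right _ (by norm_num)
      omega
    -- The small neighbourhood is enlarged to exactly `30 * s` checks, so that only sets of one size
    -- enter the union bound.
    obtain ⟨T, hT, -, hTc⟩ := Finset.exists_subsuperset_card_eq
      (Finset.subset_univ ((S ×ˢ Finset.univ).image f)) hf.le
      (by rw [Finset.card_univ, Fintype.card_fin]; exact hSM)
    simp only [Finset.mem_biUnion, Finset.mem_powersetCard]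
    refine ⟨S.card, ?_, S, ⟨Finset.subset_univ _, rfl⟩, T, ⟨Finset.subset_univ _, hTc⟩, ?_⟩
    · simp only [R, Finset.mem_filter, Finset.mem_range]
      exact ⟨by omega, hSpos, hS⟩
    · simp only [B, Finset.mem_filter, Finset.mem_univ, true_and]
      intro e he
      exact hT (Finset.mem_image_of_mem f he)
  have hcard := Finset.card_le_card hcover
  rw [Finset.card_univ, Fintype.card_fun, Fintype.card_fin, Fintype.card_prod, Fintype.card_fin,
    Fintype.card_fin, show 4 * M * 32 = 128 * M by ring] at hcard
  have hB : ∀ s, ∀ S ∈ Finset.powersetCard s (Finset.univ : Finset (Fin (4 * M))),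
      ∀ T ∈ Finset.powersetCard (30 * s) (Finset.univ : Finset (Fin M)),
      (B S T).card = (30 * s) ^ (32 * s) * M ^ (128 * M - 32 * s) := by
    intro s S hS T hT
    rw [Finset.mem_powersetCard] at hS hT
    rw [card_functions_into, Finset.card_product, hS.2, hT.2, Finset.card_univ, Fintype.card_fin,
      Fintype.card_prod, Fintype.card_fin, Fintype.card_fin, show 4 * M * 32 = 128 * M by ring,
      mul_comm s 32]
  have hsum : M ^ (128 * M) ≤ ∑ s ∈ R, (4 * M).choose s * (M.choose (30 * s) *
      ((30 * s) ^ (32 * s) * M ^ (128 * M - 32 * s))) := by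
    refine hcard.trans (Finset.card_biUnion_le.trans (Finset.sum_le_sum fun s _ => ?_))
    refine (Finset.card_biUnion_le_card_mul _ _ _ fun S hS =>
      Finset.card_biUnion_le_card_mul _ _ _ fun T hT => (hB s S hS T hT).le).trans ?_
    rw [Finset.card_powersetCard, Finset.card_powersetCard, Finset.card_univ, Finset.card_univ,
      Fintype.card_fin, Fintype.card_fin]
  have hsumr : (M : ℝ) ^ (128 * M) ≤ ∑ s ∈ R, (1 / 4) ^ s * (M : ℝ) ^ (128 * M) := by
    refine le_trans (by exact_mod_cast hsum) (Nat.cast_sum R _ |>.le.trans ?_)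
    refine Finset.sum_le_sum fun s hs => ?_
    simp only [R, Finset.mem_filter] at hs
    refine le_trans (le_of_eq ?_) (union_bound_term M s hs.2.1 hs.2.2)
    push_cast
    ring
  rw [← Finset.sum_mul] at hsumr
  have hMp : (0 : ℝ) < (M : ℝ) ^ (128 * M) := by positivity
  have hge : (1 : ℝ) ≤ ∑ s ∈ R, (1 / 4) ^ s := by
    by_contra h
    push Not at h
    nlinarith
  have hle : ∑ s ∈ R, (1 / 4 : ℝ) ^ s ≤ ∑ s ∈ Finset.range M, (1 / 4 : ℝ) ^ (s + 1) := by
    have h := Finset.sum_range_succ' (fun s => (1 / 4 : ℝ) ^ s) M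
    have h2 : ∑ s ∈ insert 0 R, (1 / 4 : ℝ) ^ s ≤ ∑ s ∈ Finset.range (M + 1), (1 / 4 : ℝ) ^ s := by
      refine Finset.sum_le_sum_of_subset_of_nonneg ?_ fun _ _ _ => by positivity
      intro s hs
      rcases Finset.mem_insert.1 hs with rfl | hs
      · simp
      · exact (Finset.mem_filter.1 hs).1
    rw [Finset.sum_insert (by simp [R]), h] at h2
    linarith
  have hgeo : ∑ s ∈ Finset.range M, (1 / 4 : ℝ) ^ (s + 1) ≤ 1 / 3 := by
    have : ∀ k : ℕ, ∑ s ∈ Finset.range k, (1 / 4 : ℝ) ^ (s + 1) = 1 / 3 * (1 - (1 / 4) ^ k) := by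
      intro k
      induction k with
      | zero => simp
      | succ k ih => rw [Finset.sum_range_succ, ih]; ring
    rw [this]
    have : (0 : ℝ) ≤ (1 / 4) ^ M := by positivity
    linarith
  linarith

/-- Vertices of high degree may be split into vertices of degree at most `D`. -/
theorem exists_splitting {E : Type*} [Fintype E] (M D R : ℕ) (hD : 0 < D)
    (hR : Fintype.card E + M * D ≤ R * D) (f : E → Fin M) :
    ∃ f' : E → Fin R, (∀ e e', f' e = f' e' → f e = f e') ∧
      ∀ c, (Finset.univ.filter fun e => f' e = c).card ≤ D := by
  classical
  have hrank : ∀ c : Fin M, ∃ g : E → ℕ, Set.InjOn g {e | f e = c} ∧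
      ∀ e, f e = c → g e < (Finset.univ.filter fun e => f e = c).card := by
    intro c
    let F := Finset.univ.filter fun e => f e = c
    refine ⟨fun e => if h : e ∈ F then (F.equivFin ⟨e, h⟩ : ℕ) else 0, ?_, ?_⟩
    · intro e he e' he' h
      have h1 : e ∈ F := by simpa [F] using he
      have h2 : e' ∈ F := by simpa [F] using he'
      simp only [h1, h2, dif_pos] at h
      have := F.equivFin.injective (Fin.ext h)
      exact congrArg Subtype.val this
    · intro e he
      have h1 : e ∈ F := by simpa [F] using he
      simp only [h1, dif_pos]
      exact Fin.isLt _
  choose g hinj hlt using hrank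
  -- The edges at a check are numbered and cut into groups of `D` consecutive ones. A check of
  -- degree `d` needs at most `d / D + 1` groups, whence the hypothesis `hR`.
  let p : E → Σ _ : Fin M, ℕ := fun e => ⟨f e, g (f e) e / D⟩
  let I := (Finset.univ : Finset (Fin M)).sigma fun c =>
    Finset.range ((Finset.univ.filter fun e => f e = c).card / D + 1)
  have hp : ∀ e, p e ∈ I := by
    intro e
    simp only [I, p, Finset.mem_sigma, Finset.mem_univ, true_and, Finset.mem_range]
    exact Nat.lt_succ_of_le (Nat.div_le_div_right (hlt _ _ rfl).le)
  have hI : I.card ≤ R := by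
    simp only [I, Finset.card_sigma, Finset.card_range]
    refine Nat.le_of_mul_le_mul_right (le_trans ?_ hR) hD
    rw [Finset.sum_mul]
    have h1 : ∑ c : Fin M, (Finset.univ.filter fun e => f e = c).card = Fintype.card E := by
      rw [← Finset.card_univ]
      exact (Finset.card_eq_sum_card_fiberwise fun e _ => Finset.mem_univ (f e)).symm
    calc _ ≤ ∑ c : Fin M, ((Finset.univ.filter fun e => f e = c).card + D) := by
          refine Finset.sum_le_sum fun c _ => ?_
          rw [add_mul, one_mul]
          exact Nat.add_le_add_right (Nat.div_mul_le_self _ _) _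
      _ = _ := by rw [Finset.sum_add_distrib, h1]; simp
  let j : I → Fin R := fun z => Fin.castLE hI (I.equivFin z)
  have hj : Function.Injective j := (Fin.castLE_injective hI).comp I.equivFin.injective
  have hpj : ∀ e e', j ⟨p e, hp e⟩ = j ⟨p e', hp e'⟩ → p e = p e' := fun e e' h =>
    congrArg Subtype.val (hj h)
  refine ⟨fun e => j ⟨p e, hp e⟩, fun e e' h => congrArg Sigma.fst (hpj e e' h), fun c => ?_⟩
  by_cases hc : ∃ e₀, j ⟨p e₀, hp e₀⟩ = c
  · obtain ⟨e₀, rfl⟩ := hc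
    refine (Finset.card_le_card_of_injOn (g (f e₀))
      (t := Finset.Ico (g (f e₀) e₀ / D * D) (g (f e₀) e₀ / D * D + D)) ?_ ?_).trans (by simp)
    · intro e he
      have h := hpj _ _ (Finset.mem_filter.1 he).2
      have h1 : f e = f e₀ := congrArg Sigma.fst h
      have h2 : g (f e) e / D = g (f e₀) e₀ / D := congrArg Sigma.snd h
      rw [h1] at h2
      simp only [Finset.coe_Ico, Set.mem_Ico]
      rw [← h2]
      exact ⟨Nat.div_mul_le_self _ _, Nat.lt_div_mul_add hD⟩
    · intro e he e' he' h
      have h1 : f e = f e₀ := congrArg Sigma.fst (hpj _ _ (Finset.mem_filter.1 he).2)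
      have h1' : f e' = f e₀ := congrArg Sigma.fst (hpj _ _ (Finset.mem_filter.1 he').2)
      exact hinj (f e₀) h1 h1' h
  · rw [Finset.filter_false_of_mem fun e _ h => hc ⟨e, h⟩]
    simp

/-- Splitting preserves expansion, because the old neighbourhood is an image of the new one. The
average degree is `128`, so splitting at `128` at most doubles the number of checks. -/
theorem exists_bounded_degree_expander (M : ℕ) (hM : 0 < M) :
    ∃ f : Fin (4 * M) × Fin 32 → Fin (2 * M),
      (∀ c, (Finset.univ.filter fun e => f e = c).card ≤ 128) ∧
      ∀ S : Finset (Fin (4 * M)), 3 ^ 30 * 43200 * S.card ≤ M →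
        30 * S.card ≤ ((S ×ˢ Finset.univ).image f).card := by
  classical
  obtain ⟨f, hf⟩ := exists_expander M hM
  obtain ⟨f', h1, h2⟩ := exists_splitting M 128 (2 * M) (by norm_num) (by
    simp only [Fintype.card_prod, Fintype.card_fin]; omega) f
  refine ⟨f', h2, fun S hS => (hf S hS).trans ?_⟩
  have hE : Nonempty (Fin (4 * M) × Fin 32) := ⟨⟨⟨0, by omega⟩, 0⟩⟩
  have h3 : ∀ e, f (Function.invFun f' (f' e)) = f e := fun e =>
    h1 _ _ (Function.invFun_eq ⟨e, rfl⟩)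
  have : (S ×ˢ Finset.univ).image f =
      ((S ×ˢ Finset.univ).image f').image (fun c => f (Function.invFun f' c)) := by
    rw [Finset.image_image]
    exact Finset.image_congr fun e _ => (h3 e).symm
  rw [this]
  exact Finset.card_image_le

/-! ### Expander codes and bit flipping -/

theorem zmod_two_eq_one {b : ZMod 2} (h : b ≠ 0) : b = 1 := by
  revert b; decide

/-- The parity-check matrix of the bipartite multigraph with the edges `(v, i)`, which connect the
variable `v` with the check `f (v, i)`. -/
def edgeMatrix {n R d : ℕ} (f : Fin n × Fin d → Fin R) : Matrix (Fin R) (Fin n) (ZMod 2) :=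
  Matrix.of fun c v => ∑ i, if f (v, i) = c then 1 else 0

theorem edgeMatrix_mulVec {n R d : ℕ} (f : Fin n × Fin d → Fin R) (x : Fin n → ZMod 2)
    (c : Fin R) : (edgeMatrix f *ᵥ x) c = ∑ e with f e = c, x e.1 := by
  simp only [Matrix.mulVec, dotProduct, edgeMatrix, Matrix.of_apply, Finset.sum_mul,
    Finset.sum_filter, Fintype.sum_prod_type, ite_mul, one_mul, zero_mul]

theorem edgeMatrix_mulVec_eq_card {n R d : ℕ} (f : Fin n × Fin d → Fin R) (x : Fin n → ZMod 2)
    (c : Fin R) : (edgeMatrix f *ᵥ x) c =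
      (((Finset.univ.filter fun v => x v ≠ 0) ×ˢ Finset.univ).filter fun e => f e = c).card := by
  rw [edgeMatrix_mulVec, Finset.card_filter, Finset.sum_product, Finset.sum_filter,
    Fintype.sum_prod_type, Finset.sum_filter]
  push_cast
  refine Finset.sum_congr rfl fun v _ => ?_
  by_cases h : x v = 0
  · simp [h]
  · simp [zmod_two_eq_one h]

/-- Flip all variables for which a majority of the checks is unsatisfied. -/
def flips {n R : ℕ} (f : Fin n × Fin 32 → Fin R) (s : Fin R → ZMod 2) : Fin n → ZMod 2 :=
  fun v => if 16 < (Finset.univ.filter fun i => s (f (v, i)) ≠ 0).card then 1 else 0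

def flipRound {n R : ℕ} (f : Fin n × Fin 32 → Fin R) (s : Fin R → ZMod 2) (x : Fin n → ZMod 2) :
    Fin n → ZMod 2 :=
  x + flips f (s + edgeMatrix f *ᵥ x)

/-- The parallel bit-flipping algorithm of Sipser and Spielman with `k` rounds. -/
def flipDecode {n R : ℕ} (f : Fin n × Fin 32 → Fin R) (k : ℕ) (s : Fin R → ZMod 2) :
    Fin n → ZMod 2 :=
  (flipRound f s)^[k] 0

theorem card_filter_product {α β : Type*} [Fintype β] (A : Finset α)
    (p : α × β → Prop) [DecidablePred p] :
    ((A ×ˢ Finset.univ).filter p).card =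
      ∑ v ∈ A, (Finset.univ.filter fun i => p (v, i)).card := by
  simp only [Finset.card_filter, Finset.sum_product]

/-- A round at least halves the number of errors. -/
theorem two_mul_hammingNorm_add_flips_le {n R K : ℕ} (f : Fin n × Fin 32 → Fin R)
    (hf : ∀ S : Finset (Fin n), S.card ≤ K →
      30 * S.card ≤ ((S ×ˢ Finset.univ).image f).card)
    (r : Fin n → ZMod 2) (hr : 2 * hammingNorm r ≤ K) :
    2 * hammingNorm (r + flips f (edgeMatrix f *ᵥ r)) ≤ hammingNorm r := by
  classical
  obtain ⟨S, hS⟩ : ∃ S, S = Finset.univ.filter fun v => r v ≠ 0 := ⟨_, rfl⟩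
  have hmem : ∀ v, v ∈ S ↔ r v ≠ 0 := by simp [hS]
  have hwt : hammingNorm r = S.card := by rw [hS]; rfl
  obtain ⟨y, hy⟩ : ∃ y, y = edgeMatrix f *ᵥ r := ⟨_, rfl⟩
  obtain ⟨mult, hmult⟩ : ∃ mult : Fin R → ℕ, mult = fun c =>
    ((S ×ˢ Finset.univ).filter fun e => f e = c).card := ⟨_, rfl⟩
  have hym : ∀ c, y c = mult c := by
    intro c
    rw [hy, edgeMatrix_mulVec_eq_card, ← hS, hmult]
  obtain ⟨N, hN⟩ : ∃ N, N = (S ×ˢ (Finset.univ : Finset (Fin 32))).image f := ⟨_, rfl⟩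
  have hmult_pos : ∀ c ∈ N, 1 ≤ mult c := by
    intro c hc
    rw [hN] at hc
    obtain ⟨e, he, rfl⟩ := Finset.mem_image.1 hc
    rw [hmult]
    exact Finset.card_pos.2 ⟨e, Finset.mem_filter.2 ⟨he, rfl⟩⟩
  have hyN : ∀ c, y c ≠ 0 → c ∈ N := by
    intro c hc
    rw [hym, hmult] at hc
    have h0 : ((S ×ˢ (Finset.univ : Finset (Fin 32))).filter fun e => f e = c).card ≠ 0 := by
      intro h; simp [h] at hc
    obtain ⟨e, he⟩ := Finset.card_pos.1 (Nat.pos_of_ne_zero h0)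
    rw [Finset.mem_filter] at he
    rw [hN, ← he.2]
    exact Finset.mem_image_of_mem f he.1
  have hSN : 30 * S.card ≤ N.card := by rw [hN]; exact hf S (by omega)
  have hcardS : (S ×ˢ (Finset.univ : Finset (Fin 32))).card = 32 * S.card := by
    rw [Finset.card_product, Finset.card_univ, Fintype.card_fin, mul_comm]
  have hNle : N.card ≤ 32 * S.card := by rw [← hcardS, hN]; exact Finset.card_image_le
  obtain ⟨U, hU⟩ : ∃ U, U = N.filter fun c => mult c = 1 := ⟨_, rfl⟩
  -- Unique neighbours: `32 * |S|` edges cover at least `30 * |S|` checks, and every check outside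
  -- `U` takes at least two edges.
  have hUcard : 28 * S.card ≤ U.card := by
    have h1 : 32 * S.card = ∑ c ∈ N, mult c := by
      rw [← hcardS, hN, hmult]
      exact Finset.card_eq_sum_card_image f _
    have h2 : ∑ c ∈ N, 2 ≤ ∑ c ∈ N, (mult c + if mult c = 1 then 1 else 0) := by
      refine Finset.sum_le_sum fun c hc => ?_
      have := hmult_pos c hc
      split_ifs <;> omega
    rw [Finset.sum_add_distrib, ← h1, ← Finset.card_filter, ← hU] at h2
    simp only [Finset.sum_const, smul_eq_mul] at h2
    omega
  have hyU : ∀ c ∈ U, y c ≠ 0 := by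
    intro c hc
    rw [hU, Finset.mem_filter] at hc
    rw [hym, hc.2]
    simp
  have hW : ((S ×ˢ (Finset.univ : Finset (Fin 32))).filter fun e => f e ∉ U).card ≤
      4 * S.card := by
    have h1 := Finset.card_filter_add_card_filter_not (s := S ×ˢ (Finset.univ : Finset (Fin 32)))
      (fun e => f e ∈ U)
    have h2 : U.card ≤ ((S ×ˢ (Finset.univ : Finset (Fin 32))).filter fun e => f e ∈ U).card := by
      refine (Finset.card_le_card ?_).trans (Finset.card_image_le (f := f))
      intro c hc
      have hc' := hc
      rw [hU, Finset.mem_filter, hN] at hc'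
      obtain ⟨e, he, rfl⟩ := Finset.mem_image.1 hc'.1
      exact Finset.mem_image_of_mem f (Finset.mem_filter.2 ⟨he, hc⟩)
    omega
  obtain ⟨cnt, hcnt⟩ : ∃ cnt : Fin n → ℕ, cnt = fun v =>
    (Finset.univ.filter fun i => y (f (v, i)) ≠ 0).card := ⟨_, rfl⟩
  have hcnt0 : ∀ v, (Finset.univ.filter fun i => y (f (v, i)) = 0).card + cnt v = 32 := by
    intro v
    rw [hcnt]
    exact (Finset.card_filter_add_card_filter_not _).trans (by simp)
  obtain ⟨F, hF⟩ : ∃ F, F = S.filter fun v => ¬ 16 < cnt v := ⟨_, rfl⟩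
  obtain ⟨G, hG⟩ : ∃ G, G = (Finset.univ.filter fun v => v ∉ S ∧ 16 < cnt v) := ⟨_, rfl⟩
  -- `F` holds the errors that are not flipped. Each sees at least `16` satisfied checks, all
  -- outside `U`, while only `4 * |S|` edges from `S` avoid `U`.
  have hFcard : 4 * F.card ≤ S.card := by
    have h1 : ((F ×ˢ (Finset.univ : Finset (Fin 32))).filter fun e => y (f e) = 0).card ≤
        4 * S.card := by
      refine (Finset.card_le_card ?_).trans hW
      intro e he
      rw [Finset.mem_filter, Finset.mem_product, hF, Finset.mem_filter] at he
      exact Finset.mem_filter.2 ⟨Finset.mem_product.2 ⟨he.1.1.1, Finset.mem_univ _⟩,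
        fun h => hyU _ h he.2⟩
    rw [card_filter_product] at h1
    have h2 : F.card * 16 ≤ ∑ v ∈ F, (Finset.univ.filter fun i => y (f (v, i)) = 0).card := by
      rw [← smul_eq_mul]
      refine Finset.card_nsmul_le_sum _ _ _ fun v hv => ?_
      rw [hF, Finset.mem_filter] at hv
      have := hcnt0 v
      omega
    omega
  -- `G` holds the correct bits that are flipped. Each has at least `17` edges into the
  -- neighbourhood `N` of `S`, so it adds at most `15` new checks, whereas expansion of `S ∪ G'`
  -- demands about `30`. The bound on `G'` keeps the union within the range of `hf`.
  have hG' : ∀ G' ⊆ G, G'.card ≤ S.card → 15 * G'.card ≤ 2 * S.card := by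
    intro G' hGG hle
    have hdisj : Disjoint S G' := by
      rw [Finset.disjoint_left]
      intro v hv hv'
      have := hGG hv'
      rw [hG, Finset.mem_filter] at this
      exact this.2.1 hv
    have h1 := hf (S ∪ G') (by rw [Finset.card_union_of_disjoint hdisj]; omega)
    rw [Finset.card_union_of_disjoint hdisj] at h1
    have h2 : ((S ∪ G') ×ˢ (Finset.univ : Finset (Fin 32))).image f ⊆
        N ∪ ((G' ×ˢ (Finset.univ : Finset (Fin 32))).filter fun e => y (f e) = 0).image f := by
      intro c hc
      obtain ⟨e, he, rfl⟩ := Finset.mem_image.1 hc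
      by_cases hN' : f e ∈ N
      · exact Finset.mem_union_left _ hN'
      · refine Finset.mem_union_right _ (Finset.mem_image_of_mem f ?_)
        rw [Finset.mem_filter, Finset.mem_product]
        refine ⟨⟨?_, Finset.mem_univ _⟩, by by_contra h; exact hN' (hyN _ h)⟩
        rcases Finset.mem_union.1 (Finset.mem_product.1 he).1 with h | h
        · refine absurd ?_ hN'
          rw [hN]
          exact Finset.mem_image_of_mem f (Finset.mem_product.2 ⟨h, Finset.mem_univ _⟩)
        · exact h
    have h3 := (Finset.card_le_card h2).trans (Finset.card_union_le _ _)
    have h4 : (((G' ×ˢ (Finset.univ : Finset (Fin 32))).filter fun e => y (f e) = 0).image f).card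
        ≤ G'.card * 15 := by
      refine Finset.card_image_le.trans ?_
      rw [card_filter_product, ← smul_eq_mul]
      refine Finset.sum_le_card_nsmul _ _ _ fun v hv => ?_
      have := hGG hv
      rw [hG, Finset.mem_filter] at this
      have h5 := hcnt0 v
      omega
    omega
  have hGcard : 15 * G.card ≤ 2 * S.card := by
    rcases Nat.eq_zero_or_pos S.card with h0 | h0
    · have hSe : S = ∅ := Finset.card_eq_zero.1 h0
      have : G = ∅ := by
        rw [Finset.eq_empty_iff_forall_notMem]
        intro v hv
        rw [hG, Finset.mem_filter, hcnt] at hv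
        obtain ⟨i, hi⟩ := Finset.card_pos.1 (lt_of_le_of_lt (Nat.zero_le _) hv.2.2)
        have := hyN _ (Finset.mem_filter.1 hi).2
        rw [hN, hSe] at this
        simp at this
      simp [this]
    · rcases le_total G.card S.card with h | h
      · exact hG' G subset_rfl h
      -- A larger `G` would contain a part of size exactly `|S|`, which contradicts the bound just
      -- shown.
      · obtain ⟨G', h1, h2⟩ := Finset.exists_subset_card_eq h
        have := hG' G' h1 h2.le
        omega
  have hsub : hammingNorm (r + flips f (edgeMatrix f *ᵥ r)) ≤ (F ∪ G).card := by
    refine Finset.card_le_card ?_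
    intro v hv
    rw [Finset.mem_filter, Pi.add_apply, flips, ← hy] at hv
    have hv2 := hv.2
    by_cases h : r v = 0
    · refine Finset.mem_union_right _ ?_
      rw [hG, Finset.mem_filter, hcnt, hmem]
      refine ⟨Finset.mem_univ _, by simp [h], ?_⟩
      by_contra h'
      rw [if_neg h', h] at hv2
      simp at hv2
    · refine Finset.mem_union_left _ ?_
      rw [hF, Finset.mem_filter, hcnt, hmem]
      refine ⟨h, fun h' => ?_⟩
      rw [if_pos h', zmod_two_eq_one h] at hv2
      exact hv2 rfl
  have := hsub.trans (Finset.card_union_le F G)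
  omega

/-- By linearity, a round sees only the syndrome of the residual error `e + x`, whose weight it
halves; after `k` rounds with `2 ^ k > n` the weight is below `1`. -/
theorem flipDecode_mulVec {n R K : ℕ} (f : Fin n × Fin 32 → Fin R)
    (hf : ∀ S : Finset (Fin n), S.card ≤ K →
      30 * S.card ≤ ((S ×ˢ Finset.univ).image f).card) (k : ℕ) (hk : n < 2 ^ k)
    (e : Fin n → ZMod 2) (he : 2 * hammingNorm e ≤ K) :
    flipDecode f k (edgeMatrix f *ᵥ e) = e := by
  have h : ∀ k, 2 ^ k * hammingNorm (e + flipDecode f k (edgeMatrix f *ᵥ e)) ≤ hammingNorm e := by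
    intro k
    induction k with
    | zero => simp [flipDecode]
    | succ k ih =>
      obtain ⟨x, hx⟩ : ∃ x, x = flipDecode f k (edgeMatrix f *ᵥ e) := ⟨_, rfl⟩
      have hstep : flipDecode f (k + 1) (edgeMatrix f *ᵥ e) =
          x + flips f (edgeMatrix f *ᵥ (e + x)) := by
        rw [flipDecode, Function.iterate_succ_apply', Matrix.mulVec_add, hx]
        rfl
      rw [← hx] at ih
      have h1 : hammingNorm (e + x) ≤ hammingNorm e :=
        le_trans (Nat.le_mul_of_pos_left _ (by positivity)) ih
      have h2 := two_mul_hammingNorm_add_flips_le f hf (e + x) (by omega)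
      rw [hstep, ← add_assoc, pow_succ]
      calc _ = 2 ^ k * (2 * hammingNorm (e + x + flips f (edgeMatrix f *ᵥ (e + x)))) := by ring
        _ ≤ 2 ^ k * hammingNorm (e + x) := by gcongr
        _ ≤ _ := ih
  have h1 := h k
  have h2 : hammingNorm e ≤ n := by simpa using hammingNorm_le_card_fintype (x := e)
  have h3 : hammingNorm (e + flipDecode f k (edgeMatrix f *ᵥ e)) = 0 := by
    by_contra h0
    have := Nat.le_mul_of_pos_right (2 ^ k) (Nat.pos_of_ne_zero h0)
    omega
  have h4 := congrFun (hammingNorm_eq_zero.1 h3)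
  funext v
  have key : ∀ a b : ZMod 2, a + b = 0 → b = a := by decide
  exact key _ _ (h4 v)

/-- Each round of the bit-flipping algorithm takes bounded time. -/
theorem Computes.exists_flipDecode : ∃ L : ℕ, ∀ (n R : ℕ) (_ : NeZero n)
    (f : Fin n × Fin 32 → Fin R),
    (∀ c, (Finset.univ.filter fun e => f e = c).card ≤ 128) →
    ∀ k, Computes n (L * (k + 1)) (flipDecode f k) := by
  classical
  -- `4129 = 1 + 32 * (1 + 128)`: a new bit depends on its old value, on the syndrome bits of its
  -- `32` checks, and on at most `128` variables at each of them.
  obtain ⟨B, hB⟩ : ∃ B, B = 4129 := ⟨_, rfl⟩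
  refine ⟨4 ^ (B + 1), fun n R _ f hf k => ?_⟩
  have hround : Computes n (4 ^ (B + 1)) (fun (y : Fin R ⊕ Fin n → ZMod 2) =>
      Sum.elim (fun c => y (Sum.inl c))
        (flipRound f (fun c => y (Sum.inl c)) (fun v => y (Sum.inr v)))) := by
    have h1 : Computes n (4 ^ (B + 1)) (fun (y : Fin R ⊕ Fin n → ZMod 2) =>
        flipRound f (fun c => y (Sum.inl c)) (fun v => y (Sum.inr v))) := by
      refine pi_unit (g := fun v (y : Fin R ⊕ Fin n → ZMod 2) =>
        flipRound f (fun c => y (Sum.inl c)) (fun v => y (Sum.inr v)) v) fun v => ?_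
      let D : Finset (Fin R ⊕ Fin n) := insert (Sum.inr v) (Finset.univ.biUnion fun i =>
        insert (Sum.inl (f (v, i)))
          ((Finset.univ.filter fun e => f e = f (v, i)).image fun e => Sum.inr e.1))
      have hD : D.card ≤ B := by
        refine (Finset.card_insert_le _ _).trans ?_
        have : (Finset.univ.biUnion fun i : Fin 32 => insert (Sum.inl (f (v, i)))
          ((Finset.univ.filter fun e => f e = f (v, i)).image
            fun e => (Sum.inr e.1 : Fin R ⊕ Fin n))).card ≤
            (Finset.univ : Finset (Fin 32)).card * 129 :=
          Finset.card_biUnion_le_card_mul _ _ _ fun i _ =>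
            (Finset.card_insert_le _ _).trans
              (Nat.succ_le_succ (Finset.card_image_le.trans (hf _)))
        rw [Finset.card_univ, Fintype.card_fin] at this
        omega
      refine (of_dependsOn D _ fun x y h => ?_).mono
        (Nat.pow_le_pow_right (by norm_num) (Nat.succ_le_succ hD))
      have hv : x (Sum.inr v) = y (Sum.inr v) := h _ (Finset.mem_insert_self _ _)
      have hs : ∀ i : Fin 32, ((fun c => x (Sum.inl c)) + edgeMatrix f *ᵥ fun v => x (Sum.inr v))
          (f (v, i)) =
          ((fun c => y (Sum.inl c)) + edgeMatrix f *ᵥ fun v => y (Sum.inr v)) (f (v, i)) := by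
        intro i
        have hsub : ∀ z, z ∈ insert (Sum.inl (f (v, i)))
          ((Finset.univ.filter fun e => f e = f (v, i)).image
            fun e => (Sum.inr e.1 : Fin R ⊕ Fin n)) → x z = y z := fun z hz =>
          h z (Finset.mem_insert_of_mem (Finset.mem_biUnion.2 ⟨i, Finset.mem_univ _, hz⟩))
        rw [Pi.add_apply, Pi.add_apply, edgeMatrix_mulVec, edgeMatrix_mulVec]
        congr 1
        · exact hsub _ (Finset.mem_insert_self _ _)
        · refine Finset.sum_congr rfl fun e he => hsub _ (Finset.mem_insert_of_mem ?_)
          exact Finset.mem_image_of_mem (fun e => (Sum.inr e.1 : Fin R ⊕ Fin n)) he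
      simp only [flipRound, Pi.add_apply (M := fun _ => ZMod 2) _ _ v, flips, hs, hv]
    refine (h1.keep.postproj
      (Sum.elim (fun c => Sum.inl (Sum.inl c)) Sum.inr : Fin R ⊕ Fin n → _)).congr ?_
    rintro y (c | v) <;> rfl
  have hiter : ∀ k, Computes n (4 ^ (B + 1) * (k + 1)) (fun s : Fin R → ZMod 2 =>
      Sum.elim s (flipDecode f k s)) := by
    intro k
    induction k with
    | zero =>
      exact ((Computes.const (κ := Fin n) 0).keep.congr (by rintro x (c | v) <;> rfl)).mono
        (Nat.mul_pos (by positivity) (by omega))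
    | succ k ih =>
      refine ((hround.comp ih).congr ?_).mono (le_of_eq (by ring))
      rintro s (c | v)
      · rfl
      · simp only [Sum.elim_inl, Sum.elim_inr, flipDecode, Function.iterate_succ_apply']
  exact (hiter k).postproj Sum.inr

/-! ### Dimension, distances and correction for CSS codes -/

namespace CSSCode

variable {N : ℕ} (Q : CSSCode N)

/-- A violated `Z`-check multiplies the amplitude by `-1`, so a fixed state vanishes there. -/
theorem zStab_mulVec_eq_zero_of_mem {ψ : QState N} (hψ : ψ ∈ Q.codeSpace) {a : Bits N}
    (ha : ψ a ≠ 0) : Q.zStab *ᵥ a = 0 := by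
  funext j
  have h1 : (-1 : ℂ) ^ (Q.zStab j ⬝ᵥ a).val * ψ a = ψ a := congrFun (hψ.2 j) a
  have h2 : (-1 : ℂ) ^ (Q.zStab j ⬝ᵥ a).val = 1 := by
    have := mul_right_cancel₀ ha (h1.trans (one_mul _).symm)
    exact this
  have key : ∀ b : ZMod 2, b = 0 ∨ b = 1 := by decide
  rcases key (Q.zStab j ⬝ᵥ a) with h | h
  · exact h
  · rw [h] at h2
    norm_num [show (1 : ZMod 2).val = 1 from rfl] at h2

theorem neg_one_pow_val_add (a b : ZMod 2) :
    (-1 : ℂ) ^ (a + b).val = (-1) ^ a.val * (-1) ^ b.val := by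
  have key : ∀ b : ZMod 2, b = 0 ∨ b = 1 := by decide
  rcases key a with rfl | rfl <;> rcases key b with rfl | rfl <;>
    simp [show (1 : ZMod 2).val = 1 from rfl, show (1 + 1 : ZMod 2) = 0 from rfl]

/-- A correction is successful if its `X`-part is the error and its `Z`-part is the error up to
a vector that is orthogonal to the kernel of `zStab`. -/
theorem corrects_of_eq {D : Q.Syndrome → (Fin N ⊕ Fin N → ZMod 2)} {u v : Bits N}
    (hu : (fun j => D (Q.syndrome u v) (Sum.inl j)) = u)
    (hv : ∀ a, Q.zStab *ᵥ a = 0 →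
      ((fun j => D (Q.syndrome u v) (Sum.inr j)) + v) ⬝ᵥ a = 0) : Q.Corrects D u v := by
  rw [Corrects, hu]
  obtain ⟨v', hv'⟩ : ∃ v' : Bits N, v' = fun j => D (Q.syndrome u v) (Sum.inr j) := ⟨_, rfl⟩
  rw [← hv'] at hv ⊢
  -- The phase comes from moving the `Z`-correction past `X(u)`.
  refine ⟨(-1) ^ (v' ⬝ᵥ u).val, by simp, fun ψ hψ => ?_⟩
  funext a
  show (-1 : ℂ) ^ (v' ⬝ᵥ (a - u)).val * ((-1) ^ (v ⬝ᵥ (a - u - u)).val * ψ (a - u - u)) =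
    (-1) ^ (v' ⬝ᵥ u).val * ψ a
  have h2 : ∀ b c : ZMod 2, b - c - c = b := by decide
  have h3 : ∀ b c : ZMod 2, b - c = b + c := by decide
  have e1 : a - u - u = a := by funext i; exact h2 _ _
  have e2 : a - u = a + u := by funext i; exact h3 _ _
  rw [e1, e2, dotProduct_add, neg_one_pow_val_add]
  by_cases h0 : ψ a = 0
  · simp [h0]
  · have h4 := hv a (Q.zStab_mulVec_eq_zero_of_mem hψ h0)
    have h5 : (-1 : ℂ) ^ (v' ⬝ᵥ a).val * (-1) ^ (v ⬝ᵥ a).val = 1 := by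
      rw [← neg_one_pow_val_add, ← add_dotProduct, h4]; simp
    linear_combination (-1 : ℂ) ^ (v' ⬝ᵥ u).val * ψ a * h5

/-- The computational basis vectors that satisfy the `Z`-checks. -/
def zKer : Submodule (ZMod 2) (Bits N) := LinearMap.ker Q.zStab.mulVecLin

def xSpan : Submodule (ZMod 2) (Bits N) := Submodule.span (ZMod 2) (Set.range Q.xStab)

theorem zStab_mulVec_xStab (i : Fin Q.rX) : Q.zStab *ᵥ Q.xStab i = 0 := by
  funext j
  have := congrFun (congrFun Q.comm i) j
  rw [Matrix.mul_apply'] at this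
  rw [Pi.zero_apply, Matrix.mulVec, dotProduct_comm]
  exact this

theorem sub_xStab_mem_zKer_iff (i : Fin Q.rX) (a : Bits N) :
    a - Q.xStab i ∈ Q.zKer ↔ a ∈ Q.zKer :=
  Submodule.sub_mem_iff_left _ (Q.zStab_mulVec_xStab i)

theorem apply_sub_of_mem_xSpan {ψ : QState N} (hψ : ψ ∈ Q.codeSpace) {w : Bits N}
    (hw : w ∈ Q.xSpan) : ∀ a, ψ (a - w) = ψ a := by
  induction hw using Submodule.span_induction with
  | mem w hw =>
    obtain ⟨i, rfl⟩ := hw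
    exact fun a => congrFun (hψ.1 i) a
  | zero => simp
  | add w w' _ _ h h' =>
    intro a
    rw [← sub_sub, h', h]
  | smul c w _ h =>
    intro a
    have key : ∀ b : ZMod 2, b = 0 ∨ b = 1 := by decide
    rcases key c with rfl | rfl
    · simp
    · rw [one_smul, h]

open Classical in
/-- The code states are the functions on the cosets of `xSpan` in `zKer`. -/
noncomputable def cosetState :
    (Q.zKer ⧸ Q.xSpan.comap Q.zKer.subtype → ℂ) →ₗ[ℂ] QState N where
  toFun φ := fun a => if h : a ∈ Q.zKer then φ (Submodule.Quotient.mk ⟨a, h⟩) else 0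
  map_add' φ φ' := by
    funext a
    by_cases h : a ∈ Q.zKer <;> simp [h]
  map_smul' c φ := by
    funext a
    by_cases h : a ∈ Q.zKer <;> simp [h]

theorem cosetState_apply_of_mem (φ : Q.zKer ⧸ Q.xSpan.comap Q.zKer.subtype → ℂ) {a : Bits N}
    (h : a ∈ Q.zKer) : Q.cosetState φ a = φ (Submodule.Quotient.mk ⟨a, h⟩) := dif_pos h

theorem cosetState_apply_of_notMem (φ : Q.zKer ⧸ Q.xSpan.comap Q.zKer.subtype → ℂ) {a : Bits N}
    (h : a ∉ Q.zKer) : Q.cosetState φ a = 0 := dif_neg h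

theorem cosetState_injective : Function.Injective Q.cosetState := by
  intro φ φ' h
  funext q
  obtain ⟨⟨a, ha⟩, rfl⟩ := Submodule.Quotient.mk_surjective _ q
  have := congrFun h a
  rwa [cosetState_apply_of_mem _ _ ha, cosetState_apply_of_mem _ _ ha] at this

/-- The `Z`-generators confine the support to `zKer`, and the `X`-generators make the amplitudes
constant on cosets of `xSpan`. -/
theorem range_cosetState : LinearMap.range Q.cosetState = Q.codeSpace := by
  apply le_antisymm
  · rintro _ ⟨φ, rfl⟩
    refine ⟨fun i => ?_, fun j => ?_⟩
    · funext a
      show Q.cosetState φ (a - Q.xStab i) = Q.cosetState φ a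
      by_cases h : a ∈ Q.zKer
      · have h' := (Q.sub_xStab_mem_zKer_iff i a).2 h
        rw [cosetState_apply_of_mem _ _ h, cosetState_apply_of_mem _ _ h']
        congr 1
        rw [Submodule.Quotient.eq, Submodule.mem_comap]
        have : Q.zKer.subtype (⟨a - Q.xStab i, h'⟩ - ⟨a, h⟩) = - Q.xStab i := by simp
        rw [this]
        exact Submodule.neg_mem _ (Submodule.subset_span ⟨i, rfl⟩)
      · rw [cosetState_apply_of_notMem _ _ h,
          cosetState_apply_of_notMem _ _ (mt (Q.sub_xStab_mem_zKer_iff i a).1 h)]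
    · funext a
      show (-1 : ℂ) ^ (Q.zStab j ⬝ᵥ a).val * Q.cosetState φ a = Q.cosetState φ a
      by_cases h : a ∈ Q.zKer
      · have : Q.zStab j ⬝ᵥ a = 0 := congrFun (LinearMap.mem_ker.1 h) j
        rw [this]; simp
      · rw [cosetState_apply_of_notMem _ _ h, mul_zero]
  · intro ψ hψ
    refine ⟨fun q => ψ (Quotient.out q).1, ?_⟩
    funext a
    by_cases h : a ∈ Q.zKer
    · rw [cosetState_apply_of_mem _ _ h]
      obtain ⟨b, hb⟩ : ∃ b, b = Quotient.out
        (Submodule.Quotient.mk ⟨a, h⟩ : Q.zKer ⧸ Q.xSpan.comap Q.zKer.subtype) := ⟨_, rfl⟩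
      rw [← hb]
      have h1 : (Submodule.Quotient.mk b : Q.zKer ⧸ Q.xSpan.comap Q.zKer.subtype) =
          Submodule.Quotient.mk ⟨a, h⟩ := by rw [hb]; exact Quotient.out_eq _
      rw [Submodule.Quotient.eq, Submodule.mem_comap] at h1
      have h2 := Q.apply_sub_of_mem_xSpan hψ h1 b.1
      rw [← h2]
      simp
    · rw [cosetState_apply_of_notMem _ _ h]
      by_contra h0
      exact h (Q.zStab_mulVec_eq_zero_of_mem hψ (Ne.symm h0))

/-- The number of logical qubits. -/
noncomputable def logicalDim : ℕ :=
  Module.finrank (ZMod 2) (Q.zKer ⧸ Q.xSpan.comap Q.zKer.subtype)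

theorem finrank_codeSpace : Module.finrank ℂ Q.codeSpace = 2 ^ Q.logicalDim := by
  classical
  have : Fintype (Q.zKer ⧸ Q.xSpan.comap Q.zKer.subtype) := Fintype.ofFinite _
  rw [← range_cosetState, LinearMap.finrank_range_of_inj Q.cosetState_injective,
    Module.finrank_fintype_fun_eq_card, Module.card_eq_pow_finrank (K := ZMod 2), ZMod.card,
    logicalDim]

theorem finrank_ker_mulVecLin_ge {r : ℕ} (H : Matrix (Fin r) (Fin N) (ZMod 2)) :
    N ≤ Module.finrank (ZMod 2) (LinearMap.ker H.mulVecLin) + r := by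
  have h1 := LinearMap.finrank_range_add_finrank_ker H.mulVecLin
  have h2 : Module.finrank (ZMod 2) (LinearMap.range H.mulVecLin) ≤ r := by
    simpa using Submodule.finrank_le (LinearMap.range H.mulVecLin)
  simp only [Module.finrank_fintype_fun_eq_card, Fintype.card_fin] at h1
  omega

theorem finrank_span_range_le {r : ℕ} (H : Matrix (Fin r) (Fin N) (ZMod 2)) :
    Module.finrank (ZMod 2) (Submodule.span (ZMod 2) (Set.range H)) ≤ r := by
  have := finrank_range_le_card (R := ZMod 2) (b := fun i => H i)
  simpa [Set.finrank] using this

theorem le_logicalDim : N ≤ Q.logicalDim + Q.rX + Q.rZ := by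
  have h1 := Submodule.finrank_quotient_add_finrank (Q.xSpan.comap Q.zKer.subtype)
  have h2 : N ≤ Module.finrank (ZMod 2) Q.zKer + Q.rZ := finrank_ker_mulVecLin_ge Q.zStab
  have h3 : Module.finrank (ZMod 2) Q.xSpan ≤ Q.rX := finrank_span_range_le Q.xStab
  have h4 : Module.finrank (ZMod 2) (Q.xSpan.comap Q.zKer.subtype) ≤
      Module.finrank (ZMod 2) Q.xSpan := by
    rw [← Submodule.finrank_map_subtype_eq]
    exact Submodule.finrank_mono (Submodule.map_comap_le _ _)
  rw [logicalDim]
  omega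

theorem exists_ker_notMem_span {r s : ℕ} (H : Matrix (Fin r) (Fin N) (ZMod 2))
    (G : Matrix (Fin s) (Fin N) (ZMod 2)) (h : r + s < N) :
    ∃ v, H *ᵥ v = 0 ∧ v ∉ Submodule.span (ZMod 2) (Set.range G) := by
  by_contra! hc
  have hle : LinearMap.ker H.mulVecLin ≤ Submodule.span (ZMod 2) (Set.range G) :=
    fun v hv => hc v hv
  have h1 := Submodule.finrank_mono hle
  have h2 := finrank_ker_mulVecLin_ge H
  have h3 := finrank_span_range_le G
  omega

/-- The infimum of the empty set is `0`, so a logical operator has to exist; the bound on the number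
of generators provides one. -/
theorem le_distZ {w : ℕ} (h : Q.rX + Q.rZ < N) (hw : ∀ v : Bits N, Q.xStab *ᵥ v = 0 →
    v ∉ Submodule.span (ZMod 2) (Set.range Q.zStab) → w ≤ hammingNorm v) : w ≤ Q.distZ := by
  obtain ⟨v, h1, h2⟩ := exists_ker_notMem_span Q.xStab Q.zStab h
  refine le_csInf ⟨_, v, h1, h2, rfl⟩ ?_
  rintro _ ⟨v, h1, h2, rfl⟩
  exact hw v h1 h2

theorem le_distX {w : ℕ} (h : Q.rX + Q.rZ < N) (hw : ∀ u : Bits N, Q.zStab *ᵥ u = 0 →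
    u ∉ Submodule.span (ZMod 2) (Set.range Q.xStab) → w ≤ hammingNorm u) : w ≤ Q.distX := by
  obtain ⟨v, h1, h2⟩ := exists_ker_notMem_span Q.zStab Q.xStab (by omega)
  refine le_csInf ⟨_, v, h1, h2, rfl⟩ ?_
  rintro _ ⟨v, h1, h2, rfl⟩
  exact hw v h1 h2

end CSSCode

/-! ### Concatenation with the repetition code -/

/-- The parities of `n` blocks of `q + 1` bits. -/
def blockParity {n q : ℕ} (v : Bits (n * (q + 1))) : Fin n → ZMod 2 :=
  fun b => ∑ l, v (finProdFinEquiv (b, l))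

theorem hammingNorm_blockParity_le {n q : ℕ} (v : Bits (n * (q + 1))) :
    hammingNorm (blockParity v) ≤ hammingNorm v := by
  classical
  refine (Finset.card_le_card ?_).trans
    (Finset.card_image_le (f := fun j => (finProdFinEquiv.symm j : Fin n × Fin (q + 1)).1)
      (s := Finset.univ.filter fun j => v j ≠ 0))
  intro b hb
  rw [Finset.mem_filter] at hb
  obtain ⟨l, -, hl⟩ := Finset.exists_ne_zero_of_sum_ne_zero hb.2
  exact Finset.mem_image.2 ⟨finProdFinEquiv (b, l), by simpa using hl,
    by rw [Equiv.symm_apply_apply]⟩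

theorem sum_blocks {n q : ℕ} {A : Type*} [AddCommMonoid A] (F : Fin (n * (q + 1)) → A) :
    ∑ j, F j = ∑ b, ∑ l, F (finProdFinEquiv (b, l)) := by
  rw [← Equiv.sum_comp finProdFinEquiv, Fintype.sum_prod_type]

/-- The generators of the repetition code: they compare bit `i + 1` of the block `b` with bit `0`. -/
def starCheck {n q : ℕ} (s : Fin n × Fin q) : Bits (n * (q + 1)) :=
  Pi.single (finProdFinEquiv (s.1, 0)) 1 + Pi.single (finProdFinEquiv (s.1, s.2.succ)) 1

theorem starCheck_dotProduct {n q : ℕ} (s : Fin n × Fin q) (u : Bits (n * (q + 1))) :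
    starCheck s ⬝ᵥ u =
      u (finProdFinEquiv (s.1, 0)) + u (finProdFinEquiv (s.1, s.2.succ)) := by
  rw [starCheck, add_dotProduct, single_one_dotProduct, single_one_dotProduct]

/-- The classical code with the parity-check matrix `H` protects against `Z`-errors. It is
concatenated with the repetition code of length `q + 1`, which protects against `X`-errors. -/
def concatCode {n R : ℕ} (H : Matrix (Fin R) (Fin n) (ZMod 2)) (q : ℕ) :
    CSSCode (n * (q + 1)) where
  rX := R
  rZ := n * q
  xStab := Matrix.of fun c j => H c (finProdFinEquiv.symm j).1
  zStab := Matrix.of fun s => starCheck (finProdFinEquiv.symm s)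
  comm := by
    ext c s
    rw [Matrix.mul_apply']
    show _ ⬝ᵥ starCheck (finProdFinEquiv.symm s) = 0
    rw [dotProduct_comm, starCheck_dotProduct]
    simp only [Matrix.of_apply, Equiv.symm_apply_apply]
    exact CharTwo.add_self_eq_zero _

section concat

variable {n R q : ℕ} (H : Matrix (Fin R) (Fin n) (ZMod 2))

theorem concatCode_zStab_mulVec (u : Bits (n * (q + 1))) (b : Fin n) (i : Fin q) :
    ((concatCode H q).zStab *ᵥ u) (finProdFinEquiv (b, i)) =
      u (finProdFinEquiv (b, 0)) + u (finProdFinEquiv (b, i.succ)) := by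
  show starCheck (finProdFinEquiv.symm (finProdFinEquiv (b, i))) ⬝ᵥ u = _
  rw [Equiv.symm_apply_apply, starCheck_dotProduct]

theorem concatCode_xStab_mulVec (v : Bits (n * (q + 1))) :
    (concatCode H q).xStab *ᵥ v = H *ᵥ blockParity v := by
  funext c
  show ∑ j, H c (finProdFinEquiv.symm j).1 * v j = ∑ b, H c b * blockParity v b
  rw [sum_blocks]
  simp only [Equiv.symm_apply_apply, blockParity, Finset.mul_sum]

theorem eq_of_concatCode_zStab_mulVec_eq_zero {u : Bits (n * (q + 1))}
    (hu : (concatCode H q).zStab *ᵥ u = 0) (b : Fin n) (l : Fin (q + 1)) :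
    u (finProdFinEquiv (b, l)) = u (finProdFinEquiv (b, 0)) := by
  refine Fin.cases rfl (fun i => ?_) l
  have h := concatCode_zStab_mulVec H u b i
  rw [hu] at h
  have key : ∀ x y : ZMod 2, 0 = x + y → y = x := by decide
  exact key _ _ h

/-- `u` is constant on each block, so only the block parities of `w` enter the product. -/
theorem dotProduct_eq_zero_of_blockParity {w u : Bits (n * (q + 1))}
    (hw : blockParity w = 0) (hu : (concatCode H q).zStab *ᵥ u = 0) : w ⬝ᵥ u = 0 := by
  rw [dotProduct, sum_blocks]
  refine Finset.sum_eq_zero fun b _ => ?_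
  simp only [eq_of_concatCode_zStab_mulVec_eq_zero H hu b]
  rw [← Finset.sum_mul]
  have : blockParity w b = 0 := congrFun hw b
  rw [blockParity] at this
  rw [this, zero_mul]

/-- Star checks can match all bits other than bit `0` of each block; the vanishing parity then
forces agreement at bit `0`. -/
theorem mem_span_zStab_of_blockParity {v : Bits (n * (q + 1))} (hv : blockParity v = 0) :
    v ∈ Submodule.span (ZMod 2) (Set.range (concatCode H q).zStab) := by
  have hs : ∀ s : Fin n × Fin q, starCheck s ∈
      Submodule.span (ZMod 2) (Set.range (concatCode H q).zStab) := fun s =>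
    Submodule.subset_span ⟨finProdFinEquiv s, by
      show starCheck (finProdFinEquiv.symm (finProdFinEquiv s)) = _
      rw [Equiv.symm_apply_apply]⟩
  have : v = ∑ s : Fin n × Fin q, v (finProdFinEquiv (s.1, s.2.succ)) • starCheck s := by
    funext j
    obtain ⟨⟨b, l⟩, rfl⟩ := finProdFinEquiv.surjective j
    rw [Finset.sum_apply, Fintype.sum_prod_type]
    rw [Finset.sum_eq_single b]
    · simp only [Pi.smul_apply, smul_eq_mul, starCheck, Pi.add_apply, Pi.single_apply,
        EmbeddingLike.apply_eq_iff_eq, Prod.mk.injEq, true_and]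
      refine Fin.cases ?_ (fun i => ?_) l
      · have h0 : blockParity v b = 0 := congrFun hv b
        rw [blockParity, Fin.sum_univ_succ] at h0
        have key : ∀ x y : ZMod 2, x + y = 0 → x = y := by decide
        rw [key _ _ h0]
        refine Finset.sum_congr rfl fun i _ => ?_
        simp [(Fin.succ_ne_zero i).symm]
      · rw [Finset.sum_eq_single i]
        · simp [Fin.succ_ne_zero]
        · intro i' _ hi'
          have : ¬ i = i' := fun h => hi' h.symm
          simp [Fin.succ_ne_zero, this]
        · simp
    · intro b' _ hb'
      refine Finset.sum_eq_zero fun i _ => ?_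
      have : ¬ b = b' := fun h => hb' h.symm
      simp [starCheck, this]
    · simp
  rw [this]
  exact Submodule.sum_mem _ fun s _ => Submodule.smul_mem _ _ (hs s)

/-- Decode all blocks by `g`, and the outer code by `φ`. -/
def concatDecode (H : Matrix (Fin R) (Fin n) (ZMod 2)) (g : (Fin q → ZMod 2) → Fin (q + 1) → ZMod 2)
    (φ : (Fin R → ZMod 2) → Fin n → ZMod 2) (s : (concatCode H q).Syndrome) :
    Fin (n * (q + 1)) ⊕ Fin (n * (q + 1)) → ZMod 2 :=
  Sum.elim
    (fun j => g (fun i => s (Sum.inr (finProdFinEquiv ((finProdFinEquiv.symm j).1, i))))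
      (finProdFinEquiv.symm j).2)
    (fun j => if (finProdFinEquiv.symm j).2 = 0
      then φ (fun c => s (Sum.inl c)) (finProdFinEquiv.symm j).1 else 0)

/-- The `X`-error is recovered exactly. Of the `Z`-error only the block parities are recovered and
placed on bit `0` of the blocks, which suffices on code states. -/
theorem concatDecode_corrects {g : (Fin q → ZMod 2) → Fin (q + 1) → ZMod 2}
    {φ : (Fin R → ZMod 2) → Fin n → ZMod 2}
    (hg : ∀ u : Fin (q + 1) → ZMod 2, 2 * hammingNorm u < q + 1 →
      g (fun i => u 0 + u i.succ) = u) {u v : Bits (n * (q + 1))}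
    (hu : ∀ b, 2 * hammingNorm (fun l => u (finProdFinEquiv (b, l))) < q + 1)
    (hv : φ (H *ᵥ blockParity v) = blockParity v) :
    (concatCode H q).Corrects (concatDecode H g φ) u v := by
  apply CSSCode.corrects_of_eq
  · funext j
    obtain ⟨⟨b, l⟩, rfl⟩ := finProdFinEquiv.surjective j
    simp only [concatDecode, Sum.elim_inl, Equiv.symm_apply_apply]
    have h := hg _ (hu b)
    simp only [← concatCode_zStab_mulVec H u b] at h
    exact congrFun h l
  · intro a ha
    refine dotProduct_eq_zero_of_blockParity H ?_ ha
    funext b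
    have h1 : (fun c => (concatCode H q).syndrome u v (Sum.inl c)) = H *ᵥ blockParity v :=
      concatCode_xStab_mulVec H v
    simp only [blockParity, Pi.add_apply, Finset.sum_add_distrib, concatDecode, Sum.elim_inr,
      Equiv.symm_apply_apply]
    erw [h1]
    rw [hv]
    simp only [Finset.sum_ite_eq', Finset.mem_univ, if_true]
    exact CharTwo.add_self_eq_zero _

theorem computes_concatDecode [NeZero n] {T₁ T₂ : ℕ}
    {g : (Fin q → ZMod 2) → Fin (q + 1) → ZMod 2} {φ : (Fin R → ZMod 2) → Fin n → ZMod 2}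
    (hg : Computes 1 T₁ g) (hφ : Computes n T₂ φ) :
    Computes n (T₁ + (T₂ + 1)) (concatDecode H g φ) := by
  have h1 := (Computes.pi (P := n) fun b => hg.preproj
    (fun i => (Sum.inr (finProdFinEquiv (b, i)) : Fin R ⊕ Fin (n * q)))).postproj
    (fun j : Fin (n * (q + 1)) => ⟨(finProdFinEquiv.symm j).1, (finProdFinEquiv.symm j).2⟩)
  have h2 := ((hφ.preproj (Sum.inl : Fin R → Fin R ⊕ Fin (n * q))).pair
    (Computes.const (κ := Unit) 0)).postproj (fun j : Fin (n * (q + 1)) =>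
      if (finProdFinEquiv.symm j).2 = 0 then Sum.inl (finProdFinEquiv.symm j).1 else Sum.inr ())
  refine (h1.pair h2).congr ?_
  rintro s (j | j)
  · rfl
  · simp only [concatDecode, Sum.elim_inr]
    split_ifs <;> rfl

/-- A nonzero vector that passes all `Z`-checks fills at least one whole block. -/
theorem le_distX_concatCode (hr : R + n * q < n * (q + 1)) :
    q + 1 ≤ (concatCode H q).distX := by
  refine CSSCode.le_distX _ hr fun u hu hspan => ?_
  have h0 : u ≠ 0 := by rintro rfl; exact hspan (Submodule.zero_mem _)
  obtain ⟨j, hj⟩ := Function.ne_iff.1 h0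
  obtain ⟨⟨b, l⟩, rfl⟩ := finProdFinEquiv.surjective j
  have h1 : ∀ l', u (finProdFinEquiv (b, l')) ≠ 0 := fun l' => by
    rw [eq_of_concatCode_zStab_mulVec_eq_zero H hu b l',
      ← eq_of_concatCode_zStab_mulVec_eq_zero H hu b l]
    exact hj
  calc q + 1 = (Finset.univ : Finset (Fin (q + 1))).card := by simp
    _ ≤ hammingNorm u := Finset.card_le_card_of_injOn (fun l' => finProdFinEquiv (b, l'))
        (fun l' _ => by simpa using h1 l')
        (fun l' _ l'' _ h => (Prod.mk.inj (finProdFinEquiv.injective h)).2)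

/-- The outer decoder cannot tell a light undetected error from no error, so the parities of such an
error vanish and it is a stabilizer. -/
theorem le_distZ_concatCode (hr : R + n * q < n * (q + 1)) {K : ℕ}
    {φ : (Fin R → ZMod 2) → Fin n → ZMod 2}
    (hφ : ∀ e : Fin n → ZMod 2, 2 * hammingNorm e ≤ K → φ (H *ᵥ e) = e) :
    K / 2 + 1 ≤ (concatCode H q).distZ := by
  refine CSSCode.le_distZ _ hr fun v hv hspan => ?_
  have hv' : H *ᵥ blockParity v = 0 := (concatCode_xStab_mulVec H v).symm.trans hv
  by_contra hlt
  refine hspan (mem_span_zStab_of_blockParity H ?_)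
  have hle := hammingNorm_blockParity_le v
  have h1 := hφ (blockParity v) (by omega)
  have h2 := hφ 0 (by simp)
  rw [Matrix.mulVec_zero] at h2
  rw [hv', h2] at h1
  exact h1.symm

end concat

/-! ### Random `X`-errors -/

theorem prod_bernoulli {ι : Type*} [Fintype ι] (p : ℝ) (u : ι → ZMod 2) :
    ∏ j, (if u j = 0 then 1 - p else p) =
      p ^ hammingNorm u * (1 - p) ^ (Fintype.card ι - hammingNorm u) := by
  classical
  rw [Finset.prod_ite, Finset.prod_const, Finset.prod_const, mul_comm]
  have h := Finset.card_filter_add_card_filter_not (s := (Finset.univ : Finset ι))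
    (fun j => u j = 0)
  rw [Finset.card_univ] at h
  congr 2
  have h2 : hammingNorm u = (Finset.univ.filter fun j => ¬ u j = 0).card := rfl
  omega

theorem bernoulliProb_nonneg {N : ℕ} {p : ℝ} (h0 : 0 ≤ p) (h1 : p ≤ 1) (S : Set (Bits N)) :
    0 ≤ bernoulliProb p S := by
  have : 0 ≤ 1 - p := by linarith
  exact Finset.sum_nonneg fun u _ => Set.indicator_nonneg (fun u _ => by positivity) u

theorem bernoulliProb_mono {N : ℕ} {p : ℝ} (h0 : 0 ≤ p) (h1 : p ≤ 1) {S S' : Set (Bits N)}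
    (h : S ⊆ S') : bernoulliProb p S ≤ bernoulliProb p S' := by
  have : 0 ≤ 1 - p := by linarith
  exact Finset.sum_le_sum fun u _ =>
    Set.indicator_le_indicator_of_subset h (fun u => by positivity) u

/-- The probability that in some block of `2 h` bits at least half of the bits are wrong. -/
theorem bernoulliProb_blocks_le {n q h : ℕ} (hq : q + 1 = 2 * h) {p : ℝ} (h0 : 0 ≤ p)
    (h1 : p ≤ 1 / 2) :
    bernoulliProb p {u : Bits (n * (q + 1)) |
      ∃ b, q + 1 ≤ 2 * hammingNorm (fun l => u (finProdFinEquiv (b, l)))} ≤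
      n * (4 * p * (1 - p)) ^ h := by
  classical
  have hp1 : 0 ≤ 1 - p := by linarith
  obtain ⟨w, hw⟩ : ∃ w : ZMod 2 → ℝ, w = fun x => if x = 0 then 1 - p else p := ⟨_, rfl⟩
  have hw0 : ∀ x, 0 ≤ w x := by intro x; rw [hw]; dsimp only; split_ifs <;> assumption
  -- In a bad block `b` the probability factor is at most `(p * (1 - p)) ^ h`, because `p ≤ 1 - p`.
  -- This constant is taken out and the block gets weight `1`, so the remaining sum factorizes.
  let ψ : Fin n → Fin (n * (q + 1)) → ZMod 2 → ℝ := fun b j x =>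
    if (finProdFinEquiv.symm j : Fin n × Fin (q + 1)).1 = b then 1 else w x
  have hψ0 : ∀ b j x, 0 ≤ ψ b j x := by
    intro b j x
    simp only [ψ]
    split_ifs
    · exact zero_le_one
    · exact hw0 x
  have hterm : ∀ u : Bits (n * (q + 1)), {u : Bits (n * (q + 1)) |
      ∃ b, q + 1 ≤ 2 * hammingNorm (fun l => u (finProdFinEquiv (b, l)))}.indicator
        (fun u => p ^ hammingNorm u * (1 - p) ^ (n * (q + 1) - hammingNorm u)) u ≤
      ∑ b, (p * (1 - p)) ^ h * ∏ j, ψ b j (u j) := by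
    intro u
    have hnn : ∀ b, 0 ≤ (p * (1 - p)) ^ h * ∏ j, ψ b j (u j) := fun b =>
      mul_nonneg (by positivity) (Finset.prod_nonneg fun j _ => hψ0 _ _ _)
    refine Set.indicator_apply_le' ?_ fun _ => Finset.sum_nonneg fun b _ => hnn b
    rintro ⟨b, hb⟩
    refine le_trans ?_ (Finset.single_le_sum (fun b _ => hnn b) (Finset.mem_univ b))
    have e1 := prod_bernoulli p u
    rw [Fintype.card_fin] at e1
    have e2 : ∀ F : Fin (n * (q + 1)) → ℝ, ∏ j, F j =
        (∏ l, F (finProdFinEquiv (b, l))) *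
          ∏ b' ∈ Finset.univ.erase b, ∏ l, F (finProdFinEquiv (b', l)) := by
      intro F
      rw [← Equiv.prod_comp finProdFinEquiv, Fintype.prod_prod_type,
        Finset.mul_prod_erase _ (fun b => ∏ l, F (finProdFinEquiv (b, l))) (Finset.mem_univ b)]
    have e3 : ∏ b' ∈ Finset.univ.erase b, ∏ l, ψ b (finProdFinEquiv (b', l))
          (u (finProdFinEquiv (b', l))) =
        ∏ b' ∈ Finset.univ.erase b, ∏ l : Fin (q + 1), w (u (finProdFinEquiv (b', l))) := by
      refine Finset.prod_congr rfl fun b' hb' => Finset.prod_congr rfl fun l _ => ?_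
      simp only [ψ, Equiv.symm_apply_apply, if_neg (Finset.ne_of_mem_erase hb')]
    have e4 : ∏ l, ψ b (finProdFinEquiv (b, l)) (u (finProdFinEquiv (b, l))) = 1 := by
      simp [ψ, -finProdFinEquiv_symm_apply]
    rw [← e1, e2, e2 (fun j => ψ b j (u j)), e3, e4, one_mul]
    simp only [hw]
    refine mul_le_mul_of_nonneg_right ?_ (Finset.prod_nonneg fun b' _ =>
      Finset.prod_nonneg fun l _ => by simpa [hw] using hw0 (u (finProdFinEquiv (b', l))))
    rw [prod_bernoulli p (fun l => u (finProdFinEquiv (b, l))), Fintype.card_fin]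
    have hk2 : hammingNorm (fun l => u (finProdFinEquiv (b, l))) ≤ q + 1 := by
      simpa using hammingNorm_le_card_fintype (x := fun l => u (finProdFinEquiv (b, l)))
    obtain ⟨k, hk⟩ : ∃ k, k = hammingNorm (fun l => u (finProdFinEquiv (b, l))) := ⟨_, rfl⟩
    rw [← hk] at hb hk2 ⊢
    obtain ⟨d, rfl⟩ : ∃ d, k = h + d := Nat.exists_eq_add_of_le (by omega)
    obtain ⟨e, he⟩ : ∃ e, h = d + e := Nat.exists_eq_add_of_le (by omega)
    have hsub : q + 1 - (h + d) = e := by omega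
    have hpow : (1 - p) ^ h = (1 - p) ^ d * (1 - p) ^ e := by rw [← pow_add, ← he]
    rw [hsub, pow_add, mul_pow, hpow, mul_assoc]
    have : p ^ d ≤ (1 - p) ^ d := pow_le_pow_left₀ h0 (by linarith) _
    gcongr
  refine (Finset.sum_le_sum fun u _ => hterm u).trans ?_
  rw [Finset.sum_comm]
  have hsum : ∀ b, ∑ u : Bits (n * (q + 1)), (p * (1 - p)) ^ h * ∏ j, ψ b j (u j) =
      (4 * p * (1 - p)) ^ h := by
    intro b
    rw [← Finset.mul_sum]
    have e1 := Finset.prod_univ_sum (fun _ : Fin (n * (q + 1)) => (Finset.univ : Finset (ZMod 2)))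
      (ψ b)
    rw [Fintype.piFinset_univ] at e1
    rw [← e1, ← Equiv.prod_comp finProdFinEquiv, Fintype.prod_prod_type]
    -- The bad block contributes its `2 ^ (2 * h)` patterns, which turn `p * (1 - p)` into `4 * p *
    -- (1 - p)`; every other block contributes total probability `1`.
    have e2 : ∀ b' : Fin n, ∏ l : Fin (q + 1), ∑ x, ψ b (finProdFinEquiv (b', l)) x =
        if b' = b then 2 ^ (2 * h) else 1 := by
      intro b'
      have huniv : (Finset.univ : Finset (ZMod 2)) = {0, 1} := rfl
      by_cases hb : b' = b
      · simp only [ψ, Equiv.symm_apply_apply, hb, if_true]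
        simp [huniv, ← hq]
      · simp only [ψ, Equiv.symm_apply_apply, hb, if_false, hw]
        simp [huniv]
    simp only [e2]
    rw [Finset.prod_ite_eq' Finset.univ b, if_pos (Finset.mem_univ _), pow_mul, ← mul_pow]
    congr 1
    ring
  simp only [hsum]
  simp

/-! ### The code family and its asymptotics -/

/-- Asymmetric codes with parallel decoders, for free choices of the length `4 M` of the outer code,
the length `q + 1 = 2 ^ (r + 1)` of the repetition code, and the number `k` of rounds of
bit-flipping. -/
theorem exists_asymmetric_code : ∃ L : ℕ, ∀ M q r k : ℕ, 0 < M → 4 * M < 2 ^ k →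
    q = 2 ^ (r + 1) - 1 →
    ∃ (Q : CSSCode (4 * M * (q + 1)))
      (D : Q.Syndrome → Fin (4 * M * (q + 1)) ⊕ Fin (4 * M * (q + 1)) → ZMod 2),
      Q.rX + Q.rZ + 2 * M = 4 * M * (q + 1) ∧
      q + 1 ≤ Q.distX ∧
      M ≤ 2 * (3 ^ 30 * 43200) * Q.distZ ∧
      Computes (4 * M) (1024 * (q + 1) + (L * (k + 1) + 1)) D ∧
      ∀ u v : Bits (4 * M * (q + 1)),
        (∀ b, 2 * hammingNorm (fun l => u (finProdFinEquiv (b, l))) < q + 1) →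
        2 * (3 ^ 30 * 43200) * hammingNorm v ≤ M → Q.Corrects D u v := by
  obtain ⟨L, hL⟩ := Computes.exists_flipDecode
  obtain ⟨B, hB⟩ : ∃ B, B = 3 ^ 30 * 43200 := ⟨_, rfl⟩
  have hB0 : 0 < B := by rw [hB]; norm_num
  refine ⟨L, fun M q r k hM hk hq => ?_⟩
  obtain ⟨f, hdeg, hexp⟩ := exists_bounded_degree_expander M hM
  have hpos : 0 < 2 ^ (r + 1) := by positivity
  have hq1 : 2 ^ (r + 1) = q + 1 := by omega
  have hrep := Computes.exists_repetition_decoder r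
  rw [← hq, hq1] at hrep
  obtain ⟨g, hg, hgu⟩ := hrep
  rw [← hB] at hexp ⊢
  have hn : NeZero (4 * M) := ⟨by omega⟩
  have hφ : ∀ e : Fin (4 * M) → ZMod 2, 2 * hammingNorm e ≤ M / B →
      flipDecode f k (edgeMatrix f *ᵥ e) = e := by
    refine flipDecode_mulVec f (fun S hS => hexp S ?_) k hk
    rw [mul_comm]
    exact (Nat.le_div_iff_mul_le hB0).1 hS
  have hmul : 4 * M * (q + 1) = 4 * M * q + 4 * M := by ring
  have hr : 2 * M + 4 * M * q < 4 * M * (q + 1) := by omega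
  refine ⟨concatCode (edgeMatrix f) q, concatDecode (edgeMatrix f) g (flipDecode f k),
    ?_, le_distX_concatCode _ hr, ?_, computes_concatDecode _ hg (hL _ _ hn f hdeg k),
    fun u v hu hv => concatDecode_corrects _ hgu hu (hφ _ ?_)⟩
  · show 2 * M + 4 * M * q + 2 * M = 4 * M * (q + 1)
    omega
  · have h1 := le_distZ_concatCode (edgeMatrix f) hr hφ
    have h2 : M / B ≤ 2 * (concatCode (edgeMatrix f) q).distZ - 1 := by omega
    have h3 : M / B < 2 * (concatCode (edgeMatrix f) q).distZ := by omega
    have h4 := (Nat.div_lt_iff_lt_mul hB0).1 h3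
    exact h4.le.trans (le_of_eq (by ring))
  · rw [Nat.le_div_iff_mul_le hB0]
    have h1 := hammingNorm_blockParity_le v
    calc 2 * hammingNorm (blockParity v) * B ≤ 2 * hammingNorm v * B := by gcongr
      _ = 2 * B * hammingNorm v := by ring
      _ ≤ M := hv

/-- The lengths of the codes. -/
def codeLength (i : ℕ) : ℕ := 4 * 2 ^ (2 ^ i) * (2 ^ (i + 7 + 1) - 1 + 1)

theorem codeLength_eq (i : ℕ) : codeLength i = 1024 * 2 ^ i * 2 ^ (2 ^ i) := by
  have : 0 < 2 ^ (i + 7 + 1) := by positivity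
  rw [codeLength, Nat.sub_add_cancel this]
  ring

theorem codeLength_strictMono : StrictMono codeLength := by
  refine strictMono_nat_of_lt_succ fun i => ?_
  rw [codeLength_eq, codeLength_eq]
  have h1 : 2 ^ i < 2 ^ (i + 1) := Nat.pow_lt_pow_right (by norm_num) (by omega)
  have h2 : 2 ^ (2 ^ i) ≤ 2 ^ (2 ^ (i + 1)) := Nat.pow_le_pow_right (by norm_num) h1.le
  have h3 : 0 < 2 ^ (2 ^ (i + 1)) := by positivity
  exact Nat.mul_lt_mul_of_lt_of_le (by omega) h2 h3

theorem codeLength_le (i : ℕ) : codeLength i ≤ 2 ^ (12 * 2 ^ i) := by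
  have h1 : i < 2 ^ i := Nat.lt_two_pow_self
  rw [codeLength_eq, show 1024 * 2 ^ i * 2 ^ (2 ^ i) = 2 ^ (10 + i + 2 ^ i) by
    rw [pow_add, pow_add]; norm_num]
  exact Nat.pow_le_pow_right (by norm_num) (by omega)

theorem log_codeLength_le (i : ℕ) : Real.log (codeLength i) ≤ 12 * 2 ^ i := by
  have h0 : (0 : ℝ) < codeLength i := by rw [codeLength_eq]; positivity
  have h1 : (codeLength i : ℝ) ≤ 2 ^ (12 * 2 ^ i) := by exact_mod_cast codeLength_le i
  have h2 := Real.log_le_log h0 h1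
  rw [Real.log_pow] at h2
  push_cast at h2
  have h3 := Real.log_two_lt_d9
  have h4 : (0 : ℝ) < 12 * 2 ^ i := by positivity
  nlinarith

theorem le_log_codeLength (i : ℕ) : (2 : ℝ) ^ i ≤ 2 * Real.log (codeLength i) := by
  have h1 : (2 : ℝ) ^ (2 ^ i) ≤ codeLength i := by
    rw [codeLength_eq]
    push_cast
    have : (1 : ℝ) ≤ 1024 * 2 ^ i := by
      have : (1 : ℝ) ≤ 2 ^ i := one_le_pow₀ (by norm_num)
      linarith
    exact le_mul_of_one_le_left (by positivity) this
  have h2 := Real.log_le_log (by positivity) h1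
  rw [Real.log_pow] at h2
  push_cast at h2
  have h3 := Real.log_two_gt_d9
  have h4 : (0 : ℝ) < 2 ^ i := by positivity
  nlinarith

theorem codeLength_div_log_le (i : ℕ) :
    codeLength i / Real.log (codeLength i) ≤ 2048 * 2 ^ (2 ^ i) := by
  have h1 := le_log_codeLength i
  have h2 : (0 : ℝ) < 2 ^ i := by positivity
  rw [div_le_iff₀ (by linarith), codeLength_eq]
  push_cast
  have h3 : (0 : ℝ) < 2 ^ (2 ^ i) := by positivity
  rw [codeLength_eq] at h1
  push_cast at h1
  nlinarith

/-- The repetition code is long enough for the random errors. -/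
theorem tendsto_failure_bound {c p : ℝ} (hc : 0 < c) (h0 : 0 ≤ p) (hp : p < 1 / 4 ^ (c + 1)) :
    Tendsto (fun i => (codeLength i : ℝ) ^ c *
      ((4 * 2 ^ (2 ^ i) : ℕ) * (4 * p * (1 - p)) ^ (2 ^ (i + 7)))) atTop (𝓝 0) := by
  obtain ⟨x, hx⟩ : ∃ x : ℝ, x = 4 ^ c := ⟨_, rfl⟩
  have hx1 : 1 ≤ x := by rw [hx]; exact Real.one_le_rpow (by norm_num) hc.le
  rw [Real.rpow_add (by norm_num), Real.rpow_one, ← hx, lt_div_iff₀ (by positivity)] at hp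
  have hp4 : p ≤ 1 / 4 := by nlinarith
  obtain ⟨ρ, hρ⟩ : ∃ ρ, ρ = 4 * p * (1 - p) := ⟨_, rfl⟩
  have hρ0 : 0 ≤ ρ := by rw [hρ]; exact mul_nonneg (by linarith) (by linarith)
  have hρ1 : ρ ≤ 3 / 4 := by rw [hρ]; nlinarith
  have hρ2 : ρ * x ≤ 1 := by rw [hρ]; nlinarith [mul_nonneg h0 h0]
  rw [← hρ]
  -- With `x = 4 ^ c` the first factor is `4 ^ 6 * x ^ 6`. Half of the `128` factors `ρ` absorb `x ^
  -- 6` through `ρ * x ≤ 1`; the other half beat `4 ^ 6` through `ρ ≤ 3 / 4`.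
  have hkey : (2 : ℝ) ^ (12 * (c + 1)) * ρ ^ 128 ≤ 1 / 2 := by
    have e1 : (2 : ℝ) ^ (12 * (c + 1)) = 4 ^ 6 * x ^ 6 := by
      rw [hx, show (12 * (c + 1) : ℝ) = (2 : ℝ) * (6 * (c + 1)) by ring, Real.rpow_mul (by norm_num),
        Real.rpow_two, show ((2 : ℝ) ^ 2) = 4 by norm_num,
        show (6 * (c + 1) : ℝ) = ((6 : ℕ) : ℝ) + c * ((6 : ℕ) : ℝ) by push_cast; ring,
        Real.rpow_add (by norm_num), Real.rpow_natCast, Real.rpow_mul (by norm_num),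
        Real.rpow_natCast]
    have e2 : x ^ 6 * ρ ^ 64 ≤ 1 := by
      calc x ^ 6 * ρ ^ 64 ≤ x ^ 64 * ρ ^ 64 := by gcongr; norm_num
        _ = (ρ * x) ^ 64 := by rw [← mul_pow, mul_comm]
        _ ≤ 1 := pow_le_one₀ (by positivity) hρ2
    have e3 : ρ ^ 64 ≤ 1 / 8192 := (pow_le_pow_left₀ hρ0 hρ1 _).trans (by norm_num)
    have e4 : 0 ≤ ρ ^ 64 := by positivity
    have e5 := mul_le_mul e2 e3 e4 zero_le_one
    rw [e1, show 128 = 64 + 64 from rfl, pow_add]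
    linarith
  refine squeeze_zero (g := fun i => (1 / 2 : ℝ) ^ i) (fun i => by positivity) (fun i => ?_)
    (tendsto_pow_atTop_nhds_zero_of_lt_one (by norm_num) (by norm_num))
  have hN0 : (0 : ℝ) < codeLength i := by rw [codeLength_eq]; positivity
  have hn : ((4 * 2 ^ (2 ^ i) : ℕ) : ℝ) ≤ codeLength i := by
    have : 4 * 2 ^ (2 ^ i) ≤ codeLength i := by
      rw [codeLength]; exact Nat.le_mul_of_pos_right _ (Nat.succ_pos _)
    exact_mod_cast this
  have hN : (codeLength i : ℝ) ≤ 2 ^ (12 * 2 ^ i) := by exact_mod_cast codeLength_le i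
  calc (codeLength i : ℝ) ^ c * ((4 * 2 ^ (2 ^ i) : ℕ) * ρ ^ (2 ^ (i + 7)))
      ≤ (codeLength i : ℝ) ^ c * (codeLength i * ρ ^ (2 ^ (i + 7))) := by gcongr
    _ = (codeLength i : ℝ) ^ (c + 1) * (ρ ^ 128) ^ (2 ^ i) := by
        rw [Real.rpow_add hN0, Real.rpow_one, ← pow_mul, pow_add, mul_comm (2 ^ i) (2 ^ 7)]
        norm_num
        ring
    _ ≤ ((2 : ℝ) ^ (12 * 2 ^ i)) ^ (c + 1) * (ρ ^ 128) ^ (2 ^ i) := by gcongr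
    _ = ((2 : ℝ) ^ (12 * (c + 1)) * ρ ^ 128) ^ (2 ^ i) := by
        rw [mul_pow, ← Real.rpow_natCast, ← Real.rpow_natCast (_ ^ (12 * (c + 1))),
          ← Real.rpow_mul (by norm_num), ← Real.rpow_mul (by norm_num)]
        congr 2
        push_cast
        ring
    _ ≤ (1 / 2) ^ (2 ^ i) := by gcongr
    _ ≤ (1 / 2) ^ i :=
        pow_le_pow_of_le_one (by norm_num) (by norm_num) Nat.lt_two_pow_self.le

/-- Whether a block is bad depends on `u` alone, so the quantifier over the accompanying `Z`-errors
costs no probability. -/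
theorem correctsErrors_of_block_condition (Q : ∀ i, CSSCode (codeLength i))
    (D : ∀ i, (Q i).Syndrome → (Fin (codeLength i) ⊕ Fin (codeLength i) → ZMod 2)) {δ : ℝ}
    (h : ∀ i, ∀ u v : Bits (codeLength i),
      (∀ b : Fin (4 * 2 ^ (2 ^ i)), 2 * hammingNorm (fun l : Fin (2 ^ (i + 7 + 1) - 1 + 1) =>
        u (finProdFinEquiv (b, l))) < 2 ^ (i + 7 + 1) - 1 + 1) →
      (hammingNorm v : ℝ) ≤ δ * codeLength i / Real.log (codeLength i) →
      (Q i).Corrects (D i) u v) :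
    CorrectsErrors codeLength Q D δ := by
  refine ⟨fun i v hv => h i 0 v (fun b => ?_) hv, fun c hc p h0 hp => ?_⟩
  · have : hammingNorm (fun l : Fin (2 ^ (i + 7 + 1) - 1 + 1) =>
        (0 : Bits (codeLength i)) (finProdFinEquiv (b, l))) = 0 := hammingNorm_eq_zero.2 rfl
    omega
  · have hp4 : p ≤ 1 / 4 := by
      refine hp.le.trans (one_div_le_one_div_of_le (by norm_num) ?_)
      calc (4 : ℝ) = 4 ^ (1 : ℝ) := (Real.rpow_one _).symm
        _ ≤ 4 ^ (c + 1) := Real.rpow_le_rpow_of_exponent_le (by norm_num) (by linarith)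
    refine squeeze_zero (fun i => mul_nonneg (by positivity)
      (bernoulliProb_nonneg h0 (by linarith) _)) (fun i => ?_) (tendsto_failure_bound hc h0 hp)
    refine mul_le_mul_of_nonneg_left ?_ (by positivity)
    have hpos : 0 < 2 ^ (i + 7 + 1) := by positivity
    have hq : 2 ^ (i + 7 + 1) - 1 + 1 = 2 * 2 ^ (i + 7) := by
      rw [Nat.sub_add_cancel hpos]; ring
    refine le_trans (bernoulliProb_mono h0 (by linarith) ?_)
      (bernoulliProb_blocks_le (n := 4 * 2 ^ (2 ^ i)) hq h0 (by linarith))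
    rintro u ⟨v, hv, hbad⟩
    by_contra hgood
    refine hbad (h i u v (fun b => ?_) hv)
    by_contra hb
    exact hgood ⟨b, not_lt.1 hb⟩

/-- The family of codes, for which the length of the repetition code is `256 * 2 ^ i`. -/
theorem exists_code_family : ∃ (L : ℕ) (Q : ∀ i, CSSCode (codeLength i))
    (D : ∀ i, (Q i).Syndrome → Fin (codeLength i) ⊕ Fin (codeLength i) → ZMod 2),
    (∀ i, (Q i).rX + (Q i).rZ + 2 * 2 ^ (2 ^ i) = codeLength i) ∧
    (∀ i, 256 * 2 ^ i ≤ (Q i).distX) ∧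
    (∀ i, 2 ^ (2 ^ i) ≤ 2 * (3 ^ 30 * 43200) * (Q i).distZ) ∧
    (∀ i, Computes (4 * 2 ^ (2 ^ i)) ((262145 + 5 * L) * 2 ^ i) (D i)) ∧
    ∀ i, ∀ u v : Bits (codeLength i),
      (∀ b : Fin (4 * 2 ^ (2 ^ i)), 2 * hammingNorm (fun l : Fin (2 ^ (i + 7 + 1) - 1 + 1) =>
        u (finProdFinEquiv (b, l))) < 2 ^ (i + 7 + 1) - 1 + 1) →
      2 * (3 ^ 30 * 43200) * hammingNorm v ≤ 2 ^ (2 ^ i) → (Q i).Corrects (D i) u v := by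
  obtain ⟨L, hL⟩ := exists_asymmetric_code
  have hrounds : ∀ E : ℕ, 4 * 2 ^ E < 2 ^ (E + 3) := fun E => by
    have : 0 < 2 ^ E := by positivity
    rw [pow_add]; omega
  have hqi : ∀ i : ℕ, 2 ^ (i + 7 + 1) - 1 + 1 = 256 * 2 ^ i := fun i => by
    have : 0 < 2 ^ (i + 7 + 1) := by positivity
    rw [Nat.sub_add_cancel this]; ring
  choose Q D hr hX hZ hD hcor using fun i : ℕ =>
    hL (2 ^ (2 ^ i)) (2 ^ (i + 7 + 1) - 1) (i + 7) (2 ^ i + 3) (by positivity) (hrounds _) rfl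
  refine ⟨L, Q, D, hr, fun i => (hqi i).symm.le.trans (hX i), hZ, fun i => (hD i).mono ?_, hcor⟩
  -- The majority votes take `1024 * 256 * 2 ^ i = 262144 * 2 ^ i` steps, and the `2 ^ i + 3` rounds
  -- take `L * (2 ^ i + 4) ≤ 5 * L * 2 ^ i`.
  have h1 : 1 ≤ 2 ^ i := Nat.one_le_two_pow
  rw [hqi]
  nlinarith [Nat.mul_le_mul_left L h1]

theorem corollary3 :
    ∃ (N : ℕ → ℕ) (Q : ∀ i, CSSCode (N i)) (k : ℕ → ℕ) (δ C : ℝ),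
      StrictMono N ∧ (∀ i, 2 ≤ N i) ∧ 0 < δ ∧ 0 < C ∧
      -- at most `N` stabilizer generators are measured
      (∀ i, (Q i).rX + (Q i).rZ ≤ N i) ∧
      -- the parameters `[[N, Ω(N / log N), Ω(N / log N) / Ω(log N)]]`
      (∀ i, Module.finrank ℂ (Q i).codeSpace = 2 ^ k i) ∧
      (∀ i, δ * N i / Real.log (N i) ≤ k i) ∧
      (∀ i, δ * N i / Real.log (N i) ≤ (Q i).distZ) ∧
      (∀ i, δ * Real.log (N i) ≤ (Q i).distX) ∧
      -- sequential decoding in time `O(N)`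
      (∃ (T : ℕ → ℕ) (A : ∀ i, Decoder (Q i) 1 (T i)),
        (∀ i, (T i : ℝ) ≤ C * N i) ∧
        CorrectsErrors N Q (fun i => (A i).eval) δ) ∧
      -- parallel decoding in time `O(log N)` on `O(N)` processors
      (∃ (P T : ℕ → ℕ) (A : ∀ i, Decoder (Q i) (P i) (T i)),
        (∀ i, (P i : ℝ) ≤ C * N i) ∧ (∀ i, (T i : ℝ) ≤ C * Real.log (N i)) ∧
        CorrectsErrors N Q (fun i => (A i).eval) δ) := by
  obtain ⟨L, Q, D, hr, hX, hZ, hD, hcor⟩ := exists_code_family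
  obtain ⟨B, hB⟩ : ∃ B : ℕ, B = 3 ^ 30 * 43200 := ⟨_, rfl⟩
  have hB1 : 1 ≤ B := by rw [hB]; norm_num
  simp only [← hB] at hZ hcor
  have hBr : (1 : ℝ) ≤ B := by exact_mod_cast hB1
  -- Chosen so that `N / log N ≤ 2048 * M` turns weight `δ * N / log N` into at most `M / (2 * B)`,
  -- the radius of the outer decoder.
  obtain ⟨δ, hδ⟩ : ∃ δ : ℝ, δ = 1 / (4096 * B) := ⟨_, rfl⟩
  have hδ0 : 0 < δ := by rw [hδ]; positivity
  have hδ1 : δ ≤ 1 := by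
    rw [hδ, div_le_one (by positivity)]; linarith
  have hδN : ∀ i, δ * codeLength i / Real.log (codeLength i) * (2 * B) ≤ 2 ^ (2 ^ i) := by
    intro i
    have h := codeLength_div_log_le i
    calc _ = δ * (2 * B) * (codeLength i / Real.log (codeLength i)) := by ring
      _ ≤ δ * (2 * B) * (2048 * 2 ^ (2 ^ i)) := by gcongr
      _ = 2 ^ (2 ^ i) := by rw [hδ]; field_simp; norm_num
  have hδN0 : ∀ i, 0 ≤ δ * codeLength i / Real.log (codeLength i) := fun i =>
    div_nonneg (by positivity) (Real.log_natCast_nonneg _)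
  have hcorr : CorrectsErrors codeLength Q D δ := by
    refine correctsErrors_of_block_condition Q D fun i u v hu hv => hcor i u v hu ?_
    have h1 : (2 * B * hammingNorm v : ℝ) ≤ 2 ^ (2 ^ i) := by
      refine le_trans ?_ (hδN i)
      rw [mul_comm]
      gcongr
    exact_mod_cast h1
  choose A hA using hD
  have hAD : (fun i => (A i).eval) = D := by
    funext i x
    exact hA i x
  -- Time times processors is of order `2 ^ i * 2 ^ 2 ^ i`, hence linear in the length, and the
  -- simulated decoder is the same map `D`.
  choose A' hA' using fun i => Computes.sequential ⟨A i, hA i⟩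
  have hAD' : (fun i => (A' i).eval) = D := by
    funext i x
    exact hA' i x
  refine ⟨codeLength, Q, fun i => (Q i).logicalDim, δ, 2 * (262145 + 5 * L), codeLength_strictMono,
    fun i => ?_, hδ0, by positivity, fun i => ?_, fun i => (Q i).finrank_codeSpace, fun i => ?_,
    fun i => ?_, fun i => ?_, ⟨_, A', fun i => ?_, ?_⟩,
    ⟨_, _, A, fun i => ?_, fun i => ?_, ?_⟩⟩
  · rw [codeLength_eq]
    have h1 : 1 ≤ 2 ^ i := Nat.one_le_two_pow
    have h2 : 1 ≤ 2 ^ (2 ^ i) := Nat.one_le_two_pow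
    nlinarith
  · have := hr i
    omega
  · have h1 : 2 * 2 ^ (2 ^ i) ≤ (Q i).logicalDim := by
      have h2 := (Q i).le_logicalDim
      have h3 := hr i
      omega
    have h2 : (2 : ℝ) * 2 ^ (2 ^ i) ≤ (Q i).logicalDim := by exact_mod_cast h1
    have h3 : (0 : ℝ) < 2 ^ (2 ^ i) := by positivity
    nlinarith [hδN i, hδN0 i]
  · have h1 : (2 : ℝ) ^ (2 ^ i) ≤ 2 * B * (Q i).distZ := by exact_mod_cast hZ i
    have h2 := (hδN i).trans h1
    rw [mul_comm] at h2
    exact le_of_mul_le_mul_left h2 (by positivity)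
  · have h2 : (256 : ℝ) * 2 ^ i ≤ (Q i).distX := by exact_mod_cast hX i
    have h3 := log_codeLength_le i
    have h4 : 0 ≤ Real.log (codeLength i) := Real.log_natCast_nonneg _
    have h5 : (0 : ℝ) < 2 ^ i := by positivity
    nlinarith
  · rw [codeLength_eq]
    push_cast
    have h2 : (0 : ℝ) ≤ (262145 + 5 * L) * 2 ^ i * 2 ^ (2 ^ i) := by positivity
    linarith
  · rw [hAD']
    exact hcorr
  · have h1 : 4 * 2 ^ (2 ^ i) ≤ codeLength i := by
      rw [codeLength]; exact Nat.le_mul_of_pos_right _ (Nat.succ_pos _)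
    have h2 : ((4 * 2 ^ (2 ^ i) : ℕ) : ℝ) ≤ codeLength i := by exact_mod_cast h1
    have h3 : (0 : ℝ) ≤ L * codeLength i := by positivity
    have h4 : (0 : ℝ) ≤ codeLength i := by positivity
    linarith
  · have h1 := mul_le_mul_of_nonneg_left (le_log_codeLength i)
      (show (0 : ℝ) ≤ 262145 + 5 * L by positivity)
    push_cast
    linarith
  · rw [hAD]
    exact hcorr
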